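/- Let $0<m\le n$ with $(m,n)\ne(1,1),(1,2)$. Let $J^{m,n}=J^{m,n}(\mathbb R,\mathbb R^2)\cong\mathbb R^{m+n+3}$ be the mixed jet space with coordinates $(x,y_0,\dots,y_m,z_0,\dots,z_n)$ and Cartan distribution $\mathcal C=\mathrm{Ann}\{dy_i-y_{i+1}dx,\ dz_j-z_{j+1}dx \mid 0\le i<m,\ 0\le j<n\}$. A Lie transformation is a diffeomorphism between open subsets of $J^{m,n}$ whose differential maps $\mathcal C$ onto $\mathcal C$. A non-degenerate Monge equation is a hypersurface $\mathcal E=\{y_m=F(x,y_0,\dots,y_{m-1},z_0,\dots,z_n)\}\subset J^{m,n}$, where $F$ is a $C^\infty$ function on an open set $U\subseteq\mathbb R^{m+n+2}$ with $\partial^2F/\partial z_n^2\neq0$ at every point of $U$; it carries the rank 2 distribution $\Delta_{\mathcal E}=T\mathcal E\cap\mathcal C$. Let $\widehat{\mathcal E}\subseteq J^{m,n}$ be the open set of points whose coordinates other than $y_m$ form a point of $U$ (so $\widehat{\mathcal E}=J^{m,n}$ if $U=\mathbb R^{m+n+2}$). (a) For every non-degenerate Monge equation $\mathcal E$ the algebra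 of internal infinitesimal symmetries coincides with the algebra of external infinitesimal symmetries. Precisely, every smooth vector field $X$ on $\mathcal E$ preserving $\Delta_{\mathcal E}$ is the restriction of a unique smooth vector field $V$ on $\widehat{\mathcal E}$ that preserves $\mathcal C$ and is tangent to $\mathcal E$; moreover, if $V'$ is a smooth vector field on any open $O\subseteq J^{m,n}$ that preserves $\mathcal C$ and equals $X$ on $O\cap\mathcal E$, then $V'=V$ near every point of $O\cap\mathcal E$. Conversely, every smooth vector field on an open neighbourhood of $\mathcal E$ that preserves $\mathcal C$ and is tangent to $\mathcal E$ restricts to a vector field on $\mathcal E$ preserving $\Delta_{\mathcal E}$, and restriction commutes with Lie brackets. (b) Let $\mathcal E,\mathcal E'$ be two non-degenerate Monge equations with the same $(m,n)$, and let $\Psi:\mathcal E\to\mathcal E'$ be an internal equivalence, i.e. a diffeomorphism with $\Psi_*\Delta_{\mathcal E}=\Delta_{\mathcal E'}$. If $(m,n)=(2,2)$, assume in addition that $\Psi$ maps the line field spanned by $\partial_{z_n}$ in the internal coordinates $(x,y_0,\dots,y_{m-1},z_0,\dots,z_n)$ of $\mathcal E$ to the corresponding line field on $\mathcal E'$. Then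 there is a Lie transformation $\Phi$, from an open neighbourhood of $\mathcal E$ onto an open neighbourhood of $\mathcal E'$, with $\Phi(\mathcal E)=\mathcal E'$ and $\Phi|_{\mathcal E}=\Psi$. It is unique as a germ along $\mathcal E$: every Lie transformation $\Phi'$ that agrees with $\Psi$ on the part of $\mathcal E$ in its domain agrees with $\Phi$ near every point of that part. If both right-hand sides are defined on all of $\mathbb R^{m+n+2}$, then there is exactly one Lie transformation of the whole space $J^{m,n}$ onto itself mapping $\mathcal E$ to $\mathcal E'$ and inducing $\Psi$. -/

import Mathlib

open scoped ContDiff Topology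

/-! Smooth distributions on open subsets of normed spaces. -/

/-- `Φ` is a smooth diffeomorphism from its source onto its target (both open) whose differential
maps the distribution `D` onto the distribution `D'`. -/
def IsDistributionEquiv {X Y : Type*} [NormedAddCommGroup X] [NormedSpace ℝ X]
    [NormedAddCommGroup Y] [NormedSpace ℝ Y]
    (D : X → Submodule ℝ X) (D' : Y → Submodule ℝ Y) (Φ : OpenPartialHomeomorph X Y) : Prop :=
  ContDiffOn ℝ ∞ Φ Φ.source ∧ ContDiffOn ℝ ∞ Φ.symm Φ.target ∧
    ∀ p ∈ Φ.source, (D p).map (fderiv ℝ Φ p : X →ₗ[ℝ] Y) = D' (Φ p)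

/-- `V` is a smooth vector field on the open set `O` which is an infinitesimal symmetry of the
distribution `D`: its bracket with every smooth (local) section of `D` is a section of `D`. -/
def IsInfinitesimalSymmetry {X : Type*} [NormedAddCommGroup X] [NormedSpace ℝ X]
    (D : X → Submodule ℝ X) (O : Set X) (V : X → X) : Prop :=
  ContDiffOn ℝ ∞ V O ∧
    ∀ O' : Set X, IsOpen O' → O' ⊆ O → ∀ S : X → X, ContDiffOn ℝ ∞ S O' →
      (∀ p ∈ O', S p ∈ D p) → ∀ p ∈ O', VectorField.lieBracket ℝ V S p ∈ D p

/-! Mixed jets. -/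

/-- The mixed jet space `J^{m,n}(ℝ, ℝ²)` in its standard global coordinates
`(x, (y_0, …, y_m), (z_0, …, z_n))`. -/
abbrev MixedJet (m n : ℕ) : Type := ℝ × (Fin (m + 1) → ℝ) × (Fin (n + 1) → ℝ)

/-- The Cartan distribution of `J^{m,n}(ℝ, ℝ²)`: the common kernel of the forms
`dy_i - y_{i+1} dx` (`0 ≤ i < m`) and `dz_j - z_{j+1} dx` (`0 ≤ j < n`). It has rank 3. -/
def cartan {m n : ℕ} (q : MixedJet m n) : Submodule ℝ (MixedJet m n) where
  carrier := {v | (∀ i : Fin m, v.2.1 i.castSucc = q.2.1 i.succ * v.1) ∧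
    ∀ j : Fin n, v.2.2 j.castSucc = q.2.2 j.succ * v.1}
  zero_mem' := by simp
  add_mem' := by
    rintro v w ⟨hv, hv'⟩ ⟨hw, hw'⟩
    refine ⟨fun i => ?_, fun j => ?_⟩
    · simp only [Prod.snd_add, Prod.fst_add, Pi.add_apply, hv, hw, mul_add]
    · simp only [Prod.snd_add, Prod.fst_add, Pi.add_apply, hv', hw', mul_add]
  smul_mem' := by
    rintro c v ⟨hv, hv'⟩
    refine ⟨fun i => ?_, fun j => ?_⟩
    · simp only [Prod.smul_snd, Prod.smul_fst, Pi.smul_apply, smul_eq_mul, hv]; ring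
    · simp only [Prod.smul_snd, Prod.smul_fst, Pi.smul_apply, smul_eq_mul, hv']; ring

/-- A (possibly only locally defined) Lie transformation of the mixed jet space. -/
def IsLieTransformation {m n : ℕ} (Φ : OpenPartialHomeomorph (MixedJet m n) (MixedJet m n)) :
    Prop :=
  IsDistributionEquiv cartan cartan Φ

/-! Monge equations. -/

/-- The space of internal coordinates `(x, (y_0, …, y_{m-1}), (z_0, …, z_n))` of a Monge
equation. -/
abbrev MongeCoord (m n : ℕ) : Type := ℝ × (Fin m → ℝ) × (Fin (n + 1) → ℝ)

/-- The coordinate vector field `∂/∂z_n`. -/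
noncomputable def dzTop (m n : ℕ) : MongeCoord m n := (0, 0, Pi.single (Fin.last n) 1)

/-- A Monge equation `y_m = F(x, y_0, …, y_{m-1}, z_0, …, z_n)`, with `F` smooth on an open set. -/
structure MongeEquation (m n : ℕ) where
  /-- the domain of the right-hand side -/
  dom : Set (MongeCoord m n)
  /-- the right-hand side -/
  F : MongeCoord m n → ℝ
  isOpen_dom : IsOpen dom
  contDiffOn_F : ContDiffOn ℝ ∞ F dom

namespace MongeEquation

variable {m n : ℕ}

/-- The non-degeneracy condition: `∂²F/∂z_n² ≠ 0` at every point. -/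
def NonDegenerate (E : MongeEquation m n) : Prop :=
  ∀ p ∈ E.dom, fderiv ℝ (fun q => fderiv ℝ E.F q (dzTop m n)) p (dzTop m n) ≠ 0

/-- The inclusion of the equation, parametrized by its internal coordinates, into `J^{m,n}`. -/
noncomputable def embed (E : MongeEquation m n) (p : MongeCoord m n) : MixedJet m n :=
  (p.1, Fin.snoc (α := fun _ => ℝ) p.2.1 (E.F p), p.2.2)

/-- The equation as a hypersurface of (an open subset of) `J^{m,n}`. -/
def carrier (E : MongeEquation m n) : Set (MixedJet m n) := E.embed '' E.dom

/-- The open set of all points of `J^{m,n}` (with arbitrary `y_m`) whose remaining coordinates lie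
in the domain of the right-hand side. It is all of `J^{m,n}` if `F` is defined everywhere. -/
def cylinder (E : MongeEquation m n) : Set (MixedJet m n) :=
  {q | ((q.1, Fin.init q.2.1, q.2.2) : MongeCoord m n) ∈ E.dom}

/-- The distribution induced on the equation by the Cartan distribution, in internal
coordinates. -/
noncomputable def distribution (E : MongeEquation m n) (p : MongeCoord m n) : Submodule ℝ (MongeCoord m n) :=
  (cartan (E.embed p)).comap (fderiv ℝ E.embed p : MongeCoord m n →ₗ[ℝ] MixedJet m n)

/-- An internal infinitesimal symmetry: a vector field on the equation preserving the induced
distribution. -/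
def IsInternalSymmetry (E : MongeEquation m n) (X : MongeCoord m n → MongeCoord m n) : Prop :=
  IsInfinitesimalSymmetry E.distribution E.dom X

/-- The vector field `V` on the subset `O` of `J^{m,n}` restricts to the vector field `X` on the
part of the equation that lies in `O`. -/
def RestrictsTo (E : MongeEquation m n) (O : Set (MixedJet m n))
    (V : MixedJet m n → MixedJet m n) (X : MongeCoord m n → MongeCoord m n) : Prop :=
  ∀ p ∈ E.dom, E.embed p ∈ O → V (E.embed p) = fderiv ℝ E.embed p (X p)

/-- An external infinitesimal symmetry on the open subset `O` of `J^{m,n}`: an infinitesimal Lie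
transformation (a vector field preserving the Cartan distribution) that is tangent to the
equation. -/
def IsExternalSymmetryOn (E : MongeEquation m n) (O : Set (MixedJet m n))
    (V : MixedJet m n → MixedJet m n) : Prop :=
  IsInfinitesimalSymmetry cartan O V ∧
    ∀ p ∈ E.dom, E.embed p ∈ O → ∃ w : MongeCoord m n, V (E.embed p) = fderiv ℝ E.embed p w

/-- An internal equivalence: a diffeomorphism of the two equations, in internal coordinates,
mapping one induced distribution onto the other. -/
def IsInternalEquiv (E E' : MongeEquation m n)
    (Ψ : OpenPartialHomeomorph (MongeCoord m n) (MongeCoord m n)) : Prop :=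
  Ψ.source = E.dom ∧ Ψ.target = E'.dom ∧ IsDistributionEquiv E.distribution E'.distribution Ψ

/-- `Ψ` maps the line field spanned by `∂/∂z_n` to itself. -/
def PreservesTopLine (E : MongeEquation m n)
    (Ψ : OpenPartialHomeomorph (MongeCoord m n) (MongeCoord m n)) : Prop :=
  ∀ p ∈ E.dom, ∃ c : ℝ, fderiv ℝ Ψ p (dzTop m n) = c • dzTop m n

/-- An external equivalence: a Lie transformation, defined on a neighbourhood of the first
equation, mapping it onto the second one. -/
def IsExternalEquiv (E E' : MongeEquation m n)
    (Φ : OpenPartialHomeomorph (MixedJet m n) (MixedJet m n)) : Prop :=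
  IsLieTransformation Φ ∧ E.carrier ⊆ Φ.source ∧ Φ '' E.carrier = E'.carrier

/-- `Φ` induces `Ψ` on the part of the equation that lies in the source of `Φ`. -/
def Induces (E E' : MongeEquation m n)
    (Φ : OpenPartialHomeomorph (MixedJet m n) (MixedJet m n))
    (Ψ : OpenPartialHomeomorph (MongeCoord m n) (MongeCoord m n)) : Prop :=
  ∀ p ∈ E.dom, E.embed p ∈ Φ.source → Φ (E.embed p) = E'.embed (Ψ p)

end MongeEquation

/-! On the equation the induced distribution is spanned by the total derivative D and Z = ∂/∂z_n.
With Y = ∂/∂y_{m-1} and T = ∂/∂z_{n-1} one has [Z, D] = F_z Y + T =: W and [Z, W] = F_zz Y, so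
non-degeneracy recovers Y and T from brackets. A map into the jet space that respects the
distributions has components with dP = P' dX along D and Z (`MongeFrame.Contact`). Bracketing these
relations yields information along W, then Y, then T.

The core is `PreservesFibers`. Along Z an equivalence, or a symmetry, does not change x, the y_i
with i < m, or the z_j with j < n; along Y it does not change x, the y_i with i < m-1, or the z_j
with j < n-1. The first step is Z x = 0. For an equivalence with n ≥ 3, the chain z_{n-3}, …, z_n
gives (Z X)² · jac(X, z_n) = 0 (`MongeFrame.Z_sq_mul_jac`), and Z X ≠ 0 would make the differential
degenerate. For n = 2 this step uses the assumption on the line field.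

A symmetry is treated as a map x + εξ over the dual numbers. There the squared relation is empty to
first order, so relations linear in Z X are needed. For m = 1 they come from [Y, D] = F_y Y
(`MongeFrame.Z_mul_jac_of_comm_YD`). For m ≥ 2 the relations for y_m and z_n
(`MongeFrame.Z_jac_relation`) combine to 2 F_zz² Zξ = 0. The second step, Y x = 0, follows from
vanishing 2×2 minors obtained by cross-differentiation.

Changing y_m changes the total derivative only by a multiple of Y. Hence the lower components can be
kept independent of y_m, while y_m and z_n are redefined by total differentiation; this gives
`prolong` and `prolongField`. Conversely, lower components of any Lie transformation are independent
of y_m and determine the top ones. This proves uniqueness of germs, and also that the prolongations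
of Ψ and of its inverse are mutually inverse. -/

section SmoothFunctions

/-! ### Algebras of smooth functions and derivations from vector fields -/

open Classical in
/-- Extension by zero of a function defined on a set. -/
noncomputable def zeroExt {M : Type*} {U : Set M} (f : U → ℝ) (x : M) : ℝ :=
  if h : x ∈ U then f ⟨x, h⟩ else 0

lemma zeroExt_of_mem {M : Type*} {U : Set M} (f : U → ℝ) {x : M} (h : x ∈ U) :
    zeroExt f x = f ⟨x, h⟩ := by
  simp [zeroExt, h]

lemma zeroExt_eqOn {M : Type*} {U : Set M} (g : M → ℝ) :
    Set.EqOn (zeroExt (fun p : U => g p)) g U :=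
  fun _ hx => zeroExt_of_mem _ hx

variable {M : Type*} [NormedAddCommGroup M] [NormedSpace ℝ M]

/-- The algebra of smooth real functions on a subset of a normed space. -/
noncomputable def smoothFunctions (U : Set M) : Subalgebra ℝ (U → ℝ) where
  carrier := {f | ContDiffOn ℝ ∞ (zeroExt f) U}
  mul_mem' := by
    intro f g hf hg
    refine (ContDiffOn.mul hf hg).congr fun x hx => ?_
    simp [zeroExt_of_mem _ hx]
  add_mem' := by
    intro f g hf hg
    refine (ContDiffOn.add hf hg).congr fun x hx => ?_
    simp [zeroExt_of_mem _ hx]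
  algebraMap_mem' := by
    intro r
    refine (contDiffOn_const (c := r)).congr fun x hx => ?_
    simp [zeroExt_of_mem _ hx]

/-- A smooth function on the ambient space as an element of the algebra of smooth functions. -/
noncomputable def toSmooth {U : Set M} (g : M → ℝ) (hg : ContDiffOn ℝ ∞ g U) :
    smoothFunctions U :=
  ⟨fun p => g p, hg.congr (zeroExt_eqOn g)⟩

@[simp] lemma toSmooth_apply {U : Set M} (g : M → ℝ) (hg : ContDiffOn ℝ ∞ g U) (p : U) :
    (toSmooth g hg).1 p = g p := rfl

lemma zeroExt_toSmooth_eventuallyEq {U : Set M} (hU : IsOpen U) (g : M → ℝ)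
    (hg : ContDiffOn ℝ ∞ g U) {p : M} (hp : p ∈ U) :
    zeroExt (toSmooth g hg).1 =ᶠ[𝓝 p] g :=
  Filter.eventuallyEq_of_mem (hU.mem_nhds hp) (zeroExt_eqOn g)

lemma contDiffOn_fderiv_apply {N : Type*} [NormedAddCommGroup N] [NormedSpace ℝ N]
    {U : Set M} (hU : IsOpen U) {g : M → N} (hg : ContDiffOn ℝ ∞ g U)
    {ξ : M → M} (hξ : ContDiffOn ℝ ∞ ξ U) :
    ContDiffOn ℝ ∞ (fun x => fderiv ℝ g x (ξ x)) U :=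
  (hg.fderiv_of_isOpen hU (by simp)).clm_apply hξ

lemma smooth_differentiableAt {N : Type*} [NormedAddCommGroup N] [NormedSpace ℝ N]
    {U : Set M} (hU : IsOpen U) {g : M → N} (hg : ContDiffOn ℝ ∞ g U) {p : M} (hp : p ∈ U) :
    DifferentiableAt ℝ g p :=
  (hg.contDiffAt (hU.mem_nhds hp)).differentiableAt (by simp)

/-- The derivation of the algebra of smooth functions defined by a smooth vector field. -/
noncomputable def fieldDerivation {U : Set M} (hU : IsOpen U) (ξ : M → M)
    (hξ : ContDiffOn ℝ ∞ ξ U) : Derivation ℝ (smoothFunctions U) (smoothFunctions U) :=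
  Derivation.mk'
    { toFun := fun f => toSmooth (fun x => fderiv ℝ (zeroExt f.1) x (ξ x))
        (contDiffOn_fderiv_apply hU f.2 hξ)
      map_add' := by
        intro f g
        ext p
        have hf := smooth_differentiableAt hU f.2 p.2
        have hg := smooth_differentiableAt hU g.2 p.2
        have : zeroExt (f + g).1 =ᶠ[𝓝 p.1] zeroExt f.1 + zeroExt g.1 :=
          Filter.eventuallyEq_of_mem (hU.mem_nhds p.2) fun x hx => by
            simp [zeroExt_of_mem _ hx]
        change fderiv ℝ (zeroExt (f + g).1) p (ξ p) =
          fderiv ℝ (zeroExt f.1) p (ξ p) + fderiv ℝ (zeroExt g.1) p (ξ p)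
        rw [this.fderiv_eq, fderiv_add hf hg, add_apply]
      map_smul' := by
        intro c f
        ext p
        have hf := smooth_differentiableAt hU f.2 p.2
        have : zeroExt (c • f).1 =ᶠ[𝓝 p.1] c • zeroExt f.1 :=
          Filter.eventuallyEq_of_mem (hU.mem_nhds p.2) fun x hx => by
            simp [zeroExt_of_mem _ hx]
        change fderiv ℝ (zeroExt (c • f).1) p (ξ p) = c • fderiv ℝ (zeroExt f.1) p (ξ p)
        rw [this.fderiv_eq, fderiv_const_smul hf, smul_apply] }
    (by
      intro f g
      ext p
      have hf := smooth_differentiableAt hU f.2 p.2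
      have hg := smooth_differentiableAt hU g.2 p.2
      have : zeroExt (f * g).1 =ᶠ[𝓝 p.1] zeroExt f.1 * zeroExt g.1 :=
        Filter.eventuallyEq_of_mem (hU.mem_nhds p.2) fun x hx => by
          simp [zeroExt_of_mem _ hx]
      change fderiv ℝ (zeroExt (f * g).1) p (ξ p) =
        f.1 p * fderiv ℝ (zeroExt g.1) p (ξ p) + g.1 p * fderiv ℝ (zeroExt f.1) p (ξ p)
      rw [this.fderiv_eq, fderiv_mul hf hg]
      simp [zeroExt_of_mem _ p.2])

lemma fieldDerivation_apply {U : Set M} (hU : IsOpen U) (ξ : M → M)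
    (hξ : ContDiffOn ℝ ∞ ξ U) (f : smoothFunctions U) (p : U) :
    (fieldDerivation hU ξ hξ f).1 p = fderiv ℝ (zeroExt f.1) p (ξ p) := rfl

@[simp] lemma fieldDerivation_toSmooth {U : Set M} (hU : IsOpen U) (ξ : M → M)
    (hξ : ContDiffOn ℝ ∞ ξ U) (g : M → ℝ) (hg : ContDiffOn ℝ ∞ g U) (p : U) :
    (fieldDerivation hU ξ hξ (toSmooth g hg)).1 p = fderiv ℝ g p (ξ p) := by
  rw [fieldDerivation_apply, (zeroExt_toSmooth_eventuallyEq hU g hg p.2).fderiv_eq]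

lemma two_le_smooth : (2 : WithTop ℕ∞) ≤ ∞ :=
  WithTop.coe_le_coe.2 le_top

lemma isSymmSndFDerivAt_of_smooth {N : Type*} [NormedAddCommGroup N] [NormedSpace ℝ N]
    {U : Set M} (hU : IsOpen U) {g : M → N} (hg : ContDiffOn ℝ ∞ g U) {p : M} (hp : p ∈ U) :
    IsSymmSndFDerivAt ℝ g p :=
  (hg.contDiffAt (hU.mem_nhds hp)).isSymmSndFDerivAt (by simp [two_le_smooth])

lemma fderiv_fderiv_apply {N : Type*} [NormedAddCommGroup N] [NormedSpace ℝ N]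
    {U : Set M} (hU : IsOpen U) {g : M → N} (hg : ContDiffOn ℝ ∞ g U)
    {ξ : M → M} (hξ : ContDiffOn ℝ ∞ ξ U) {p : M} (hp : p ∈ U) (v : M) :
    fderiv ℝ (fun x => fderiv ℝ g x (ξ x)) p v =
      fderiv ℝ (fderiv ℝ g) p v (ξ p) + fderiv ℝ g p (fderiv ℝ ξ p v) := by
  have h1 := smooth_differentiableAt hU (hg.fderiv_of_isOpen (m := ∞) hU (by simp)) hp
  have h2 := smooth_differentiableAt hU hξ hp
  rw [fderiv_clm_apply h1 h2]
  simp [add_comm]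

/-- The commutator of a constant vector field with a vector field. -/
lemma fieldDerivation_const_comm {U : Set M} (hU : IsOpen U) (v : M) (ξ : M → M)
    (hξ : ContDiffOn ℝ ∞ ξ U) (f : smoothFunctions U) (p : U) :
    (fieldDerivation hU (fun _ => v) contDiffOn_const (fieldDerivation hU ξ hξ f)).1 p =
      (fieldDerivation hU ξ hξ (fieldDerivation hU (fun _ => v) contDiffOn_const f)).1 p +
        fderiv ℝ (zeroExt f.1) p (fderiv ℝ ξ p v) := by
  have e1 : fieldDerivation hU ξ hξ f = toSmooth (fun x => fderiv ℝ (zeroExt f.1) x (ξ x))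
      (contDiffOn_fderiv_apply hU f.2 hξ) := rfl
  have e2 : fieldDerivation hU (fun _ => v) contDiffOn_const f =
      toSmooth (fun x => fderiv ℝ (zeroExt f.1) x v)
        (contDiffOn_fderiv_apply hU f.2 contDiffOn_const) := rfl
  rw [e1, e2, fieldDerivation_toSmooth, fieldDerivation_toSmooth,
    fderiv_fderiv_apply hU f.2 hξ p.2, fderiv_fderiv_apply hU f.2 contDiffOn_const p.2,
    (isSymmSndFDerivAt_of_smooth hU f.2 p.2).eq v (ξ p)]
  simp

lemma fieldDerivation_const_comm_const {U : Set M} (hU : IsOpen U) (v w : M)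
    (f : smoothFunctions U) :
    fieldDerivation hU (fun _ => v) contDiffOn_const
        (fieldDerivation hU (fun _ => w) contDiffOn_const f) =
      fieldDerivation hU (fun _ => w) contDiffOn_const
        (fieldDerivation hU (fun _ => v) contDiffOn_const f) := by
  ext p
  rw [fieldDerivation_const_comm]
  simp

end SmoothFunctions

/-! ### Commutator algebra of a Monge frame -/

section ContactAlgebra

variable {R A : Type*} [CommRing R] [CommRing A] [Algebra R A]

/-- The coefficient-wise extension of a derivation to dual numbers. -/
noncomputable def dualDerivation (d : Derivation R A A) :
    Derivation R (DualNumber A) (DualNumber A) :=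
  Derivation.mk'
    { toFun := fun a => TrivSqZeroExt.inl (d a.fst) + TrivSqZeroExt.inr (d a.snd)
      map_add' := by intro a b; ext <;> simp
      map_smul' := by intro c a; ext <;> simp }
    (by
      intro a b
      ext
      · simp
      · simp; ring)

@[simp] lemma fst_dualDerivation (d : Derivation R A A) (a : DualNumber A) :
    (dualDerivation d a).fst = d a.fst := by simp [dualDerivation]

@[simp] lemma snd_dualDerivation (d : Derivation R A A) (a : DualNumber A) :
    (dualDerivation d a).snd = d a.snd := by simp [dualDerivation]

/-- The derivations `D, ∂/∂z_n, ∂/∂y_{m-1}, ∂/∂z_{n-1}` attached to a non-degenerate Monge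
equation with right-hand side `F`, together with `Fz = ∂F/∂z_n`, and their commutation
relations. -/
structure MongeFrame (R A : Type*) [CommRing R] [CommRing A] [Algebra R A] where
  D : Derivation R A A
  Z : Derivation R A A
  Y : Derivation R A A
  T : Derivation R A A
  Fz : A
  comm_ZD : ∀ g, Z (D g) = D (Z g) + (Fz * Y g + T g)
  comm_ZY : ∀ g, Z (Y g) = Y (Z g)
  comm_ZT : ∀ g, Z (T g) = T (Z g)
  comm_YT : ∀ g, Y (T g) = T (Y g)
  regular : ∀ g, Z Fz * g = 0 → g = 0

/-- The base change of a frame to dual numbers. -/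
noncomputable def MongeFrame.dual (K : MongeFrame R A) : MongeFrame R (DualNumber A) where
  D := dualDerivation K.D
  Z := dualDerivation K.Z
  Y := dualDerivation K.Y
  T := dualDerivation K.T
  Fz := TrivSqZeroExt.inl K.Fz
  comm_ZD g := by ext <;> simp [K.comm_ZD]
  comm_ZY g := by ext <;> simp [K.comm_ZY]
  comm_ZT g := by ext <;> simp [K.comm_ZT]
  comm_YT g := by ext <;> simp [K.comm_YT]
  regular g hg := by
    have h1 := congrArg TrivSqZeroExt.fst hg
    have h2 := congrArg TrivSqZeroExt.snd hg
    simp at h1 h2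
    ext
    · exact K.regular _ h1
    · exact K.regular _ h2

namespace MongeFrame

variable (K : MongeFrame R A)

/-- `P' = dP/dX` along the rank 2 distribution spanned by `D` and `Z`. -/
def Contact (X P P' : A) : Prop := K.D P = P' * K.D X ∧ K.Z P = P' * K.Z X

/-- The Jacobian of `(X, Q)` with respect to `(Z, D)`. -/
def jac (X Q : A) : A := K.Z X * K.D Q - K.D X * K.Z Q

/-- The bracket `[Z, D]`. -/
def W (g : A) : A := K.Fz * K.Y g + K.T g

variable {K} {X : A}

/-- Apply Z to the relation along D and D to the relation along Z, and subtract; W appears as [Z,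
D]. -/
lemma W_of_contact {P P' : A} (h : K.Contact X P P') :
    K.W P = P' * K.W X - K.jac X P' := by
  have h1 := congrArg K.Z h.1
  have h2 := congrArg K.D h.2
  rw [K.comm_ZD] at h1
  simp only [Derivation.leibniz, smul_eq_mul] at h1 h2
  rw [K.comm_ZD] at h1
  unfold W jac
  linear_combination h1 - h2

lemma jac_eq_zero {P P' : A} (h : K.Contact X P P') : K.jac X P = 0 := by
  unfold jac
  rw [h.1, h.2]; ring

lemma W_of_contact₂ {P P' P'' : A} (h : K.Contact X P P') (h' : K.Contact X P' P'') :
    K.W P = P' * K.W X := by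
  rw [W_of_contact h, jac_eq_zero h', sub_zero]

/-- T has constant coefficients, so only the factor `Fz` of Y contributes. This is where the second
derivative F_zz enters. -/
lemma comm_ZW (g : A) : K.Z (K.W g) = K.W (K.Z g) + K.Z K.Fz * K.Y g := by
  simp only [W, map_add, Derivation.leibniz, smul_eq_mul, K.comm_ZY, K.comm_ZT]
  ring

lemma W_mul (a b : A) : K.W (a * b) = a * K.W b + b * K.W a := by
  simp only [W, Derivation.leibniz, smul_eq_mul]; ring

/-- Compare Z applied to W P = P' W X with W applied to Z P = P' Z X; the difference is governed by
[Z, W] = F_zz Y. -/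
lemma Y_of_contact₂ {P P' P'' : A} (h : K.Contact X P P') (h' : K.Contact X P' P'') :
    K.Z K.Fz * (K.Y P - P' * K.Y X) = K.Z X * (P'' * K.W X - K.W P') := by
  have h1 := congrArg K.Z (W_of_contact₂ h h')
  have h2 := congrArg K.W h.2
  rw [comm_ZW] at h1
  simp only [Derivation.leibniz, smul_eq_mul, W_mul] at h1 h2
  rw [comm_ZW] at h1
  linear_combination h1 - h2 + K.W X * h'.2

/-- A third link in the chain makes the right-hand side of `Y_of_contact₂` vanish, and F_zz is not a
zero divisor. -/
lemma Y_of_contact₃ {P P' P'' P''' : A} (h : K.Contact X P P') (h' : K.Contact X P' P'')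
    (h'' : K.Contact X P'' P''') : K.Y P = P' * K.Y X := by
  have := Y_of_contact₂ h h'
  rw [W_of_contact₂ h' h'', sub_self, mul_zero] at this
  exact sub_eq_zero.1 (K.regular _ this)

/-- Cross-differentiating Y P₃ = P₂ Y X with Z P₃ = P₂ Z X gives Z X (Y P₂ - P₁ Y X) = 0. By
`Y_of_contact₂` the bracket, times F_zz, is Z X times the Jacobian of (X, P₀). -/
lemma Z_sq_mul_jac {P₃ P₂ P₁ P₀ : A} (h₃ : K.Contact X P₃ P₂) (h₂ : K.Contact X P₂ P₁)
    (h₁ : K.Contact X P₁ P₀) : K.Z X * K.Z X * K.jac X P₀ = 0 := by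
  have e := Y_of_contact₂ h₂ h₁
  rw [W_of_contact h₁] at e
  have h := congrArg K.Z (Y_of_contact₃ h₃ h₂ h₁)
  have h' := congrArg K.Y h₃.2
  rw [K.comm_ZY] at h
  simp only [Derivation.leibniz, smul_eq_mul] at h h'
  rw [K.comm_ZY] at h
  linear_combination -K.Z X * e + K.Z K.Fz * (h - h') + K.Z K.Fz * K.Y X * h₂.2

/-- The argument of `Z_sq_mul_jac` with D in place of Z in the cross-differentiation. The commutator
contributes a multiple of Y P₃ - P₂ Y X, which is zero. One factor Z X becomes D X, so the relation
survives linearisation at the identity. -/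
lemma Z_mul_jac_of_comm_YD {Fy : A} (hYD : ∀ g, K.Y (K.D g) = K.D (K.Y g) + Fy * K.Y g)
    {P₃ P₂ P₁ P₀ : A} (h₃ : K.Contact X P₃ P₂) (h₂ : K.Contact X P₂ P₁)
    (h₁ : K.Contact X P₁ P₀) : K.D X * (K.Z X * K.jac X P₀) = 0 := by
  have e := Y_of_contact₂ h₂ h₁
  rw [W_of_contact h₁] at e
  have h := congrArg K.D (Y_of_contact₃ h₃ h₂ h₁)
  have h' := congrArg K.Y h₃.1
  have h'' := Y_of_contact₃ h₃ h₂ h₁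
  rw [hYD] at h'
  simp only [Derivation.leibniz, smul_eq_mul] at h h'
  rw [hYD] at h'
  linear_combination -K.D X * e + K.Z K.Fz * (-h' + h) + K.Z K.Fz * K.Y X * h₂.1 +
    K.Z K.Fz * Fy * h''

/-- Differentiate F_zz (Y P₂ - P₁ Y X) = Z X · jac(X, P₀) along Z, and eliminate Y P₁ by means of Z
applied to W P₁ = P₀ W X - jac(X, P₀). Only two links of a chain are used, so this is available for
both y_m and z_n as soon as m, n ≥ 2. -/
lemma Z_jac_relation {P₂ P₁ P₀ : A} (h₂ : K.Contact X P₂ P₁) (h₁ : K.Contact X P₁ P₀) :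
    K.Z (K.Z K.Fz) * K.Z X * K.jac X P₀ + K.Z K.Fz * K.Z X *
      (K.Z P₀ * K.W X - K.Z (K.jac X P₀) - K.Z X * K.W P₀) =
    K.Z K.Fz * (K.Z (K.Z X) * K.jac X P₀ + K.Z X * K.Z (K.jac X P₀)) := by
  have e := Y_of_contact₂ h₂ h₁
  have w := W_of_contact h₁
  have e' : K.Z K.Fz * (K.Y P₂ - P₁ * K.Y X) = K.Z X * K.jac X P₀ := by
    rw [e, w]; ring
  have z := congrArg K.Z e'
  have w' := congrArg K.Z w
  rw [comm_ZW] at w'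
  simp only [Derivation.leibniz, smul_eq_mul, map_sub, h₁.2, W_mul] at w' z
  rw [comm_ZW] at w'
  rw [K.comm_ZY, K.comm_ZY, h₂.2] at z
  simp only [Derivation.leibniz, smul_eq_mul] at z
  linear_combination K.Z K.Fz * z - K.Z K.Fz * K.Z X * w' - K.Z (K.Z K.Fz) * e'

/-- Cross-differentiation along the commuting fields Y and T: dP = P' dX on their span forces dP' ∧
dX to vanish there. -/
lemma YT_minor {P P' : A} (hY : K.Y P = P' * K.Y X) (hT : K.T P = P' * K.T X) :
    K.Y P' * K.T X = K.T P' * K.Y X := by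
  have h := congrArg K.T hY
  have h' := congrArg K.Y hT
  rw [K.comm_YT] at h'
  simp only [Derivation.leibniz, smul_eq_mul] at h h'
  rw [K.comm_YT] at h'
  linear_combination h-h'

lemma T_of_Y {P P' : A} (hY : K.Y P = P' * K.Y X) (hW : K.W P = P' * K.W X) :
    K.T P = P' * K.T X := by
  unfold W at hW
  linear_combination hW - K.Fz * hY

/-- Once Z X = 0, two links replace the three of `Y_of_contact₃`; this reaches one order higher in
the jet coordinates and covers n = 2. -/
lemma Y_of_Z_eq_zero {P P' P'' : A} (hX : K.Z X = 0) (h : K.Contact X P P')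
    (h' : K.Contact X P' P'') : K.Y P = P' * K.Y X := by
  have := Y_of_contact₂ h h'
  rw [hX, zero_mul] at this
  exact sub_eq_zero.1 (K.regular _ this)

lemma YT_minor_of_Z_eq_zero {P P' P'' : A} (hX : K.Z X = 0) (h : K.Contact X P P')
    (h' : K.Contact X P' P'') : K.Y P' * K.T X = K.T P' * K.Y X :=
  YT_minor (Y_of_Z_eq_zero hX h h') (T_of_Y (Y_of_Z_eq_zero hX h h') (W_of_contact₂ h h'))

/-- Substitute for the y-minor when m = 1. Although Y and D do not commute, the error is F_y times
the relation Y P = P' Y X itself. -/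
lemma YD_minor_of_comm_YD {Fy : A} (hYD : ∀ g, K.Y (K.D g) = K.D (K.Y g) + Fy * K.Y g)
    {P P' P'' : A} (hX : K.Z X = 0) (h : K.Contact X P P') (h' : K.Contact X P' P'') :
    K.Y P' * K.D X = K.D P' * K.Y X := by
  have hY := Y_of_Z_eq_zero hX h h'
  have e := congrArg K.D hY
  have e' := congrArg K.Y h.1
  rw [hYD] at e'
  simp only [Derivation.leibniz, smul_eq_mul] at e e'
  rw [hYD] at e'
  linear_combination e - e' + Fy * hY

section Dual

variable {x P₂ P₁ P₀ Q₃ Q₂ Q₁ Q₀ : DualNumber A}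

/-- Here P₀ and Q₀ stand for y_m and z_n. At the identity their Jacobians with x are -F_z and -1,
and the two linearised relations become independent because F_z varies along Z. -/
lemma dual_Z_eq_zero (h2 : ∀ a : A, 2 * a = 0 → a = 0)
    (hP₂ : K.dual.Contact x P₂ P₁) (hP₁ : K.dual.Contact x P₁ P₀)
    (hQ₂ : K.dual.Contact x Q₂ Q₁) (hQ₁ : K.dual.Contact x Q₁ Q₀)
    (hDx : K.D x.fst = 1) (hZx : K.Z x.fst = 0) (hYx : K.Y x.fst = 0) (hTx : K.T x.fst = 0)
    (hZP : K.Z P₀.fst = K.Fz) (hZQ : K.Z Q₀.fst = 1) : K.dual.Z x = 0 := by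
  have r1 := congrArg TrivSqZeroExt.snd (Z_jac_relation hQ₂ hQ₁)
  have r2 := congrArg TrivSqZeroExt.snd (Z_jac_relation hP₂ hP₁)
  simp only [jac, W, dual, DualNumber.snd_mul,
    TrivSqZeroExt.fst_mul, TrivSqZeroExt.snd_add, TrivSqZeroExt.fst_add,
    TrivSqZeroExt.fst_sub, TrivSqZeroExt.snd_sub, fst_dualDerivation, snd_dualDerivation,
    TrivSqZeroExt.fst_inl, TrivSqZeroExt.snd_inl, map_add, map_sub, map_zero,
    hDx, hZx, hYx, hTx, hZQ, hZP, Derivation.map_one_eq_zero, zero_mul, mul_zero, add_zero,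
    zero_add, sub_zero, mul_one, one_mul] at r1 r2
  -- The terms with F_zzz and with the second Z-derivative of ξ cancel in this combination, leaving
  -- 2 F_zz² Zξ.
  have two : K.Z K.Fz * (K.Z K.Fz * (2 * K.Z x.snd)) = 0 := by
    linear_combination r2 - K.Fz * r1
  ext1
  · simpa [dual] using hZx
  · simpa [dual] using h2 _ (K.regular _ (K.regular _ two))

/-- At the identity D x = 1, Z x = 0 and the Jacobian of (x, z_n) is -1, so the ε-part of
`Z_mul_jac_of_comm_YD` is -Zξ. -/
lemma dual_Z_eq_zero_of_comm_YD {Fy : A} (hYD : ∀ g, K.Y (K.D g) = K.D (K.Y g) + Fy * K.Y g)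
    (hQ₃ : K.dual.Contact x Q₃ Q₂) (hQ₂ : K.dual.Contact x Q₂ Q₁)
    (hQ₁ : K.dual.Contact x Q₁ Q₀) (hDx : K.D x.fst = 1) (hZx : K.Z x.fst = 0)
    (hZQ : K.Z Q₀.fst = 1) : K.dual.Z x = 0 := by
  have hYD' : ∀ g, K.dual.Y (K.dual.D g) = K.dual.D (K.dual.Y g) +
      TrivSqZeroExt.inl Fy * K.dual.Y g := by
    intro g
    ext1
    · simpa [dual] using hYD g.fst
    · simpa [dual] using hYD g.snd
  have key := congrArg TrivSqZeroExt.snd (Z_mul_jac_of_comm_YD hYD' hQ₃ hQ₂ hQ₁)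
  simp only [jac, dual, DualNumber.snd_mul, TrivSqZeroExt.fst_mul,
    TrivSqZeroExt.fst_sub, TrivSqZeroExt.snd_sub, fst_dualDerivation, snd_dualDerivation,
    hDx, hZx, hZQ, TrivSqZeroExt.snd_zero] at key
  ext1
  · simpa [dual] using hZx
  · have : K.Z x.snd = 0 := by linear_combination -key
    simpa [dual] using this

/-- Q₁ stands for z_{n-1}. Linearised at the identity, where Y z_{n-1} = 0 and T z_{n-1} = 1, a
single (Y, T)-minor already isolates Yξ. -/
lemma dual_Y_eq_zero (hZ : K.dual.Z x = 0) (hQ₂ : K.dual.Contact x Q₂ Q₁)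
    (hQ₁ : K.dual.Contact x Q₁ Q₀) (hYx : K.Y x.fst = 0) (hTx : K.T x.fst = 0)
    (hYQ : K.Y Q₁.fst = 0) (hTQ : K.T Q₁.fst = 1) : K.dual.Y x = 0 := by
  have hmin := congrArg TrivSqZeroExt.snd (YT_minor_of_Z_eq_zero hZ hQ₂ hQ₁)
  simp only [dual, DualNumber.snd_mul, fst_dualDerivation, snd_dualDerivation,
    hYx, hTx, hYQ, hTQ] at hmin
  ext1
  · simpa [dual] using hYx
  · have : K.Y x.snd = 0 := by linear_combination -hmin
    simpa [dual] using this

end Dual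

end MongeFrame

lemma derivation_minor {V₁ V₂ : Derivation R A A} (hV : ∀ g, V₁ (V₂ g) = V₂ (V₁ g))
    {X P P' : A} (h₁ : V₁ P = P' * V₁ X) (h₂ : V₂ P = P' * V₂ X) :
    V₁ P' * V₂ X = V₂ P' * V₁ X := by
  have h := congrArg V₂ h₁
  have h' := congrArg V₁ h₂
  rw [hV] at h'
  simp only [Derivation.leibniz, smul_eq_mul] at h h'
  rw [hV] at h'
  linear_combination h - h'

end ContactAlgebra

/-! ### Infinitesimal symmetries as linearised contact equations -/

section LinearDistribution

/-- The infinitesimal symmetries of a distribution given by equations `ℓ k v = c k p * ℓ₀ v`. -/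
lemma isInfinitesimalSymmetry_iff {X ι : Type*} [NormedAddCommGroup X] [NormedSpace ℝ X]
    [Fintype ι] [DecidableEq ι] {D : X → Submodule ℝ X} {O : Set X} (hO : IsOpen O)
    {ℓ : ι → X →L[ℝ] ℝ} {ℓ₀ : X →L[ℝ] ℝ} {c : ι → X → ℝ}
    (hc : ∀ k, ContDiffOn ℝ ∞ (c k) O)
    (hD : ∀ p ∈ O, ∀ v, v ∈ D p ↔ ∀ k, ℓ k v = c k p * ℓ₀ v)
    {e : ι → X} (he : ∀ k k', ℓ k (e k') = if k = k' then 1 else 0) (he₀ : ∀ k, ℓ₀ (e k) = 0)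
    {V : X → X} :
    IsInfinitesimalSymmetry D O V ↔ ContDiffOn ℝ ∞ V O ∧ ∀ p ∈ O, ∀ v ∈ D p, ∀ k,
      ℓ k (fderiv ℝ V p v) = c k p * ℓ₀ (fderiv ℝ V p v) + fderiv ℝ (c k) p (V p) * ℓ₀ v := by
  have key : ∀ O' : Set X, IsOpen O' → O' ⊆ O → ∀ S : X → X, ContDiffOn ℝ ∞ S O' →
      (∀ p ∈ O', S p ∈ D p) → ∀ p ∈ O', ∀ k, ℓ k (fderiv ℝ S p (V p)) =
        c k p * ℓ₀ (fderiv ℝ S p (V p)) + fderiv ℝ (c k) p (V p) * ℓ₀ (S p) := by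
    intro O' hO' hsub S hS hSD p hp k
    have dS := (smooth_differentiableAt hO' hS hp).hasFDerivAt
    have dc := (smooth_differentiableAt hO (hc k) (hsub hp)).hasFDerivAt
    have h1 := (ℓ k).hasFDerivAt.comp p dS
    have h2 := dc.mul (ℓ₀.hasFDerivAt.comp p dS)
    have heq : (ℓ k ∘ S) =ᶠ[𝓝 p] (fun q => c k q * (ℓ₀ ∘ S) q) :=
      Filter.eventuallyEq_of_mem (hO'.mem_nhds hp) fun q hq =>
        (hD q (hsub hq) _).1 (hSD q hq) k
    have := (h1.congr_of_eventuallyEq heq.symm).unique h2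
    have := congrArg (fun L : X →L[ℝ] ℝ => L (V p)) this
    simpa [mul_comm] using this
  constructor
  · rintro ⟨hV, h⟩
    refine ⟨hV, fun p hp v hv k => ?_⟩
    -- A section through v: the constant field v, corrected along the dual vectors `e k` by the
    -- change of the coefficients `c k`.
    set S : X → X := fun q => v + ∑ k, ((c k q - c k p) * ℓ₀ v) • e k with hSdef
    have hS : ContDiffOn ℝ ∞ S O :=
      contDiffOn_const.add (ContDiffOn.sum fun k _ =>
        (((hc k).sub contDiffOn_const).mul contDiffOn_const).smul contDiffOn_const)
    have hSD : ∀ q ∈ O, S q ∈ D q := by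
      intro q hq
      rw [hD q hq]
      intro k
      have := (hD p hp v).1 hv k
      simp [hSdef, he, he₀, this]
      ring
    have hSp : S p = v := by simp [hSdef]
    have h1 := (hD p hp _).1 (h O hO subset_rfl S hS hSD p hp) k
    have h2 := key O hO subset_rfl S hS hSD p hp k
    rw [VectorField.lieBracket, hSp, map_sub, map_sub] at h1
    rw [hSp] at h2
    linear_combination h2 - h1
  · rintro ⟨hV, h⟩
    refine ⟨hV, fun O' hO' hsub S hS hSD p hp => (hD p (hsub hp) _).2 fun k => ?_⟩
    have h1 := h p (hsub hp) _ (hSD p hp) k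
    have h2 := key O' hO' hsub S hS hSD p hp k
    rw [VectorField.lieBracket, map_sub, map_sub]
    linear_combination h2 - h1

end LinearDistribution

/-! ### Jet coordinates and the total derivative -/

section Coordinates

variable {m n : ℕ}

/-- The projection forgetting the coordinate `y_m`. -/
noncomputable def forgetTop (m n : ℕ) : MixedJet m n →L[ℝ] MongeCoord m n :=
  LinearMap.toContinuousLinearMap
    { toFun := fun q => (q.1, Fin.init q.2.1, q.2.2)
      map_add' := fun _ _ => rfl
      map_smul' := fun _ _ => rfl }

@[simp] lemma forgetTop_apply (q : MixedJet m n) :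
    forgetTop m n q = (q.1, Fin.init q.2.1, q.2.2) := rfl

lemma snoc_add {k : ℕ} (a b : Fin k → ℝ) (s t : ℝ) :
    (Fin.snoc (a + b) (s + t) : Fin (k + 1) → ℝ) = Fin.snoc a s + Fin.snoc b t := by
  ext i
  refine Fin.lastCases ?_ (fun i => ?_) i <;> simp

lemma snoc_smul {k : ℕ} (c : ℝ) (a : Fin k → ℝ) (s : ℝ) :
    (Fin.snoc (c • a) (c * s) : Fin (k + 1) → ℝ) = c • (Fin.snoc a s : Fin (k + 1) → ℝ) := by
  ext i
  refine Fin.lastCases ?_ (fun i => ?_) i <;> simp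

lemma snoc_castSucc_succ {k : ℕ} (a : Fin (k + 1) → ℝ) (t : ℝ) (i : Fin k) :
    (Fin.snoc a t : Fin (k + 2) → ℝ) i.castSucc.succ = a i.succ := by
  rw [Fin.succ_castSucc, Fin.snoc_castSucc]

lemma snoc_one {a : Fin 1 → ℝ} (t : ℝ) : (Fin.snoc a t : Fin 2 → ℝ) 1 = t :=
  Fin.snoc_last (α := fun _ => ℝ) t a

/-- The jet with given internal coordinates and given `y_m`. -/
noncomputable def joinTop (m n : ℕ) : MongeCoord m n × ℝ →L[ℝ] MixedJet m n :=
  LinearMap.toContinuousLinearMap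
    { toFun := fun p => (p.1.1, Fin.snoc (α := fun _ => ℝ) p.1.2.1 p.2, p.1.2.2)
      map_add' := fun p q => by
        ext1
        · rfl
        · ext1
          · exact snoc_add _ _ _ _
          · rfl
      map_smul' := fun c p => by
        ext1
        · rfl
        · ext1
          · exact snoc_smul _ _ _
          · rfl }

lemma joinTop_apply (p : MongeCoord m n × ℝ) :
    joinTop m n p = (p.1.1, Fin.snoc (α := fun _ => ℝ) p.1.2.1 p.2, p.1.2.2) := rfl

@[simp] lemma joinTop_fst (p : MongeCoord m n × ℝ) : (joinTop m n p).1 = p.1.1 := rfl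
@[simp] lemma joinTop_y (p : MongeCoord m n × ℝ) :
    (joinTop m n p).2.1 = Fin.snoc (α := fun _ => ℝ) p.1.2.1 p.2 := rfl
@[simp] lemma joinTop_z (p : MongeCoord m n × ℝ) : (joinTop m n p).2.2 = p.1.2.2 := rfl

@[simp] lemma forgetTop_joinTop (p : MongeCoord m n × ℝ) :
    forgetTop m n (joinTop m n p) = p.1 := by
  simp [Fin.init_snoc]

lemma joinTop_forgetTop (q : MixedJet m n) :
    joinTop m n (forgetTop m n q, q.2.1 (Fin.last m)) = q := by
  simp [joinTop_apply]

/-- The linear part of the total derivative. -/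
noncomputable def shift (m n : ℕ) : MixedJet m n →L[ℝ] MongeCoord m n :=
  LinearMap.toContinuousLinearMap
    { toFun := fun q => (0, fun i => q.2.1 i.succ,
        Fin.snoc (α := fun _ => ℝ) (fun j : Fin n => q.2.2 j.succ) 0)
      map_add' := fun p q => by
        ext1
        · simp
        · ext1
          · rfl
          · have := snoc_add (fun j : Fin n => p.2.2 j.succ) (fun j => q.2.2 j.succ) 0 0
            rwa [add_zero] at this
      map_smul' := fun c p => by
        ext1
        · simp
        · ext1
          · rfl
          · have := snoc_smul c (fun j : Fin n => p.2.2 j.succ) 0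
            rwa [mul_zero] at this }

lemma shift_apply (q : MixedJet m n) : shift m n q = (0, fun i => q.2.1 i.succ,
    Fin.snoc (α := fun _ => ℝ) (fun j : Fin n => q.2.2 j.succ) 0) := rfl

/-- The total derivative `∂_x + ∑ y_{i+1} ∂_{y_i} + ∑ z_{j+1} ∂_{z_j}` (with `i < m`, `j < n`). -/
noncomputable def total (q : MixedJet m n) : MongeCoord m n := (1, 0, 0) + shift m n q

@[simp] lemma total_fst (q : MixedJet m n) : (total q).1 = 1 := by simp [total, shift_apply]
@[simp] lemma total_y (q : MixedJet m n) (i : Fin m) : (total q).2.1 i = q.2.1 i.succ := by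
  simp [total, shift_apply]
@[simp] lemma total_z (q : MixedJet m n) (j : Fin n) :
    (total q).2.2 j.castSucc = q.2.2 j.succ := by
  simp [total, shift_apply]
@[simp] lemma total_z_last (q : MixedJet m n) : (total q).2.2 (Fin.last n) = 0 := by
  simp [total, shift_apply]

lemma contDiff_total : ContDiff ℝ ∞ (total : MixedJet m n → MongeCoord m n) :=
  contDiff_const.add (shift m n).contDiff

lemma mem_cartan {q v : MixedJet m n} : v ∈ cartan q ↔
    (∀ i : Fin m, v.2.1 i.castSucc = q.2.1 i.succ * v.1) ∧
    ∀ j : Fin n, v.2.2 j.castSucc = q.2.2 j.succ * v.1 := Iff.rfl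

lemma forgetTop_of_mem_cartan {q v : MixedJet m n} (hv : v ∈ cartan q) :
    forgetTop m n v = v.1 • total q + v.2.2 (Fin.last n) • dzTop m n := by
  obtain ⟨h1, h2⟩ := hv
  refine Prod.ext ?_ (Prod.ext ?_ ?_)
  · simp [dzTop]
  · ext i
    simp [dzTop, Fin.init, h1, mul_comm]
  · ext j
    refine Fin.lastCases ?_ (fun j => ?_) j
    · simp [dzTop]
    · simp [dzTop, h2, mul_comm, (Fin.castSucc_lt_last j).ne]

/-- The coordinate vector field `∂/∂y_{m-1}`. -/
noncomputable def dySub (k n : ℕ) : MongeCoord (k + 1) n := (0, Pi.single (Fin.last k) 1, 0)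

/-- The coordinate vector field `∂/∂z_{n-1}`. -/
noncomputable def dzSub (m l : ℕ) : MongeCoord m (l + 1) :=
  (0, 0, Pi.single (Fin.last l).castSucc 1)

/-- With t = F_z this is the bracket [Z, D]. -/
lemma shift_joinTop_dzTop (k l : ℕ) (t : ℝ) :
    shift (k + 1) (l + 1) (joinTop _ _ (dzTop _ _, t)) = t • dySub k _ + dzSub _ l := by
  refine Prod.ext ?_ (Prod.ext ?_ ?_)
  · simp [shift_apply, dySub, dzSub]
  · ext i
    refine Fin.lastCases ?_ (fun i => ?_) i
    · simp [shift_apply, dySub, dzSub, dzTop]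
    · simp [shift_apply, dySub, dzSub, dzTop, (Fin.castSucc_lt_last i).ne, snoc_castSucc_succ]
  · ext j
    refine Fin.lastCases ?_ (fun j => ?_) j
    · simp [shift_apply, dySub, dzSub, dzTop, Pi.single_apply, Fin.ext_iff]
    · simp [shift_apply, dySub, dzSub, dzTop, Pi.single_apply, Fin.ext_iff]

/-- With t = F_y this is [Y, D] for m = 1. For m ≥ 2 the shift of ∂/∂y_{m-1} has an additional
component along ∂/∂y_{m-2}. -/
lemma shift_joinTop_dySub (n : ℕ) (t : ℝ) :
    shift 1 n (joinTop _ _ (dySub 0 n, t)) = t • dySub 0 n := by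
  refine Prod.ext ?_ (Prod.ext ?_ ?_)
  · simp [shift_apply, dySub]
  · ext i
    rw [Subsingleton.elim i (Fin.last 0)]
    simp [shift_apply, dySub, snoc_one]
  · ext j
    refine Fin.lastCases ?_ (fun j => ?_) j
    · simp [shift_apply, dySub]
    · simp [shift_apply, dySub]

/-- This is what allows information on the equation to be transported to arbitrary values of y_m. -/
lemma total_joinTop (k n : ℕ) (p : MongeCoord (k + 1) n) (s t : ℝ) :
    total (joinTop _ _ (p, t)) = total (joinTop _ _ (p, s)) + (t - s) • dySub k n := by
  refine Prod.ext ?_ (Prod.ext ?_ ?_)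
  · simp [dySub]
  · ext i
    refine Fin.lastCases ?_ (fun i => ?_) i
    · simp [dySub]
    · simp [dySub, (Fin.castSucc_lt_last i).ne, snoc_castSucc_succ]
  · ext j
    refine Fin.lastCases ?_ (fun j => ?_) j
    · simp [dySub]
    · simp [dySub]

end Coordinates

/-! ### The frame of a Monge equation -/

namespace MongeEquation

variable {m n : ℕ} (E : MongeEquation m n)

lemma embed_eq (p : MongeCoord m n) : E.embed p = joinTop m n (p, E.F p) := rfl

lemma embed_y_castSucc (p : MongeCoord m n) (i : Fin m) :
    (E.embed p).2.1 i.castSucc = p.2.1 i := by simp [embed_eq]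
lemma embed_z (p : MongeCoord m n) : (E.embed p).2.2 = p.2.2 := rfl

@[simp] lemma forgetTop_embed (p : MongeCoord m n) : forgetTop m n (E.embed p) = p := by
  rw [embed_eq, forgetTop_joinTop]

lemma contDiffOn_embed : ContDiffOn ℝ ∞ E.embed E.dom :=
  (joinTop m n).contDiff.comp_contDiffOn (contDiffOn_id.prodMk E.contDiffOn_F)

lemma hasFDerivAt_embed {p : MongeCoord m n} (hp : p ∈ E.dom) :
    HasFDerivAt E.embed (fderiv ℝ E.embed p) p :=
  (smooth_differentiableAt E.isOpen_dom E.contDiffOn_embed hp).hasFDerivAt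

lemma fderiv_embed {p : MongeCoord m n} (hp : p ∈ E.dom) (w : MongeCoord m n) :
    fderiv ℝ E.embed p w = joinTop m n (w, fderiv ℝ E.F p w) := by
  have hF := (smooth_differentiableAt E.isOpen_dom E.contDiffOn_F hp).hasFDerivAt
  have := (joinTop m n).hasFDerivAt.comp p ((hasFDerivAt_id p).prodMk hF)
  have h2 : HasFDerivAt E.embed _ p := this
  rw [h2.fderiv]
  rfl

@[simp] lemma forgetTop_fderiv_embed {p : MongeCoord m n} (hp : p ∈ E.dom)
    (w : MongeCoord m n) : forgetTop m n (fderiv ℝ E.embed p w) = w := by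
  rw [fderiv_embed _ hp, forgetTop_joinTop]

lemma mem_distribution {p : MongeCoord m n} (hp : p ∈ E.dom) {w : MongeCoord m n} :
    w ∈ E.distribution p ↔ (∀ i : Fin m, w.2.1 i = (E.embed p).2.1 i.succ * w.1) ∧
      ∀ j : Fin n, w.2.2 j.castSucc = p.2.2 j.succ * w.1 := by
  change fderiv ℝ E.embed p w ∈ cartan (E.embed p) ↔ _
  rw [mem_cartan, fderiv_embed E hp]
  simp [embed_z]

lemma mem_distribution' {p w : MongeCoord m n} :
    w ∈ E.distribution p ↔ fderiv ℝ E.embed p w ∈ cartan (E.embed p) := Iff.rfl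

lemma total_embed_mem {p : MongeCoord m n} (hp : p ∈ E.dom) :
    total (E.embed p) ∈ E.distribution p := by
  rw [mem_distribution E hp]
  simp [embed_z]

lemma dzTop_mem {p : MongeCoord m n} (hp : p ∈ E.dom) : dzTop m n ∈ E.distribution p := by
  rw [mem_distribution E hp]
  simp [dzTop, (Fin.castSucc_lt_last _).ne]

lemma contDiffOn_total_embed : ContDiffOn ℝ ∞ (fun p => total (E.embed p)) E.dom :=
  contDiff_total.comp_contDiffOn E.contDiffOn_embed

lemma fderiv_total_embed {p : MongeCoord m n} (hp : p ∈ E.dom) (v : MongeCoord m n) :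
    fderiv ℝ (fun p => total (E.embed p)) p v =
      shift m n (joinTop m n (v, fderiv ℝ E.F p v)) := by
  have h : HasFDerivAt (fun p => total (E.embed p))
      ((shift m n).comp (fderiv ℝ E.embed p)) p :=
    (((shift m n).hasFDerivAt.const_add (1, 0, 0) : HasFDerivAt total (shift m n) _)).comp p
      (E.hasFDerivAt_embed hp)
  rw [h.fderiv, ContinuousLinearMap.comp_apply, fderiv_embed E hp]

lemma contDiffOn_dF (v : MongeCoord m n) :
    ContDiffOn ℝ ∞ (fun p => fderiv ℝ E.F p v) E.dom :=
  contDiffOn_fderiv_apply E.isOpen_dom E.contDiffOn_F contDiffOn_const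

/-- The frame on the domain of a non-degenerate Monge equation. -/
noncomputable def frame {k l : ℕ} (E : MongeEquation (k + 1) (l + 1)) (hE : E.NonDegenerate) :
    MongeFrame ℝ (smoothFunctions E.dom) where
  D := fieldDerivation E.isOpen_dom (fun p => total (E.embed p)) E.contDiffOn_total_embed
  Z := fieldDerivation E.isOpen_dom (fun _ => dzTop _ _) contDiffOn_const
  Y := fieldDerivation E.isOpen_dom (fun _ => dySub k _) contDiffOn_const
  T := fieldDerivation E.isOpen_dom (fun _ => dzSub _ l) contDiffOn_const
  Fz := toSmooth (fun p => fderiv ℝ E.F p (dzTop _ _)) (E.contDiffOn_dF _)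
  comm_ZD g := by
    ext p
    rw [fieldDerivation_const_comm, fderiv_total_embed E p.2, shift_joinTop_dzTop]
    simp [fieldDerivation_apply]
  comm_ZY g := fieldDerivation_const_comm_const _ _ _ _
  comm_ZT g := fieldDerivation_const_comm_const _ _ _ _
  comm_YT g := fieldDerivation_const_comm_const _ _ _ _
  -- Elements of the algebra are functions on `E.dom` alone, so a nowhere vanishing F_zz can be
  -- cancelled pointwise.
  regular g hg := by
    ext p
    have h := congrFun (congrArg Subtype.val hg) p
    simpa [hE p.1 p.2] using h

lemma frame_comm_YD {l : ℕ} (E : MongeEquation 1 (l + 1)) (hE : E.NonDegenerate)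
    (g : smoothFunctions E.dom) :
    (E.frame hE).Y ((E.frame hE).D g) = (E.frame hE).D ((E.frame hE).Y g) +
      toSmooth (fun p => fderiv ℝ E.F p (dySub 0 _)) (E.contDiffOn_dF _) *
        (E.frame hE).Y g := by
  ext p
  simp only [frame]
  rw [fieldDerivation_const_comm, fderiv_total_embed E p.2, shift_joinTop_dySub]
  simp [fieldDerivation_apply]

end MongeEquation

/-! ### Coordinate functions and contact relations of maps -/

section JetCoordinates

variable {m n : ℕ}

/-- The coordinate function `x` on the jet space. -/
noncomputable def jetX (m n : ℕ) : MixedJet m n →L[ℝ] ℝ := ContinuousLinearMap.fst ℝ _ _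

/-- The coordinate function `y_i` on the jet space. -/
noncomputable def jetY (n : ℕ) (i : Fin (m + 1)) : MixedJet m n →L[ℝ] ℝ :=
  (ContinuousLinearMap.proj i).comp
    ((ContinuousLinearMap.fst ℝ _ _).comp (ContinuousLinearMap.snd ℝ _ _))

/-- The coordinate function `z_j` on the jet space. -/
noncomputable def jetZ (m : ℕ) (j : Fin (n + 1)) : MixedJet m n →L[ℝ] ℝ :=
  (ContinuousLinearMap.proj j).comp
    ((ContinuousLinearMap.snd ℝ _ _).comp (ContinuousLinearMap.snd ℝ _ _))

@[simp] lemma jetX_apply (q : MixedJet m n) : jetX m n q = q.1 := rfl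
@[simp] lemma jetY_apply (i : Fin (m + 1)) (q : MixedJet m n) : jetY n i q = q.2.1 i := rfl
@[simp] lemma jetZ_apply (j : Fin (n + 1)) (q : MixedJet m n) : jetZ m j q = q.2.2 j := rfl

lemma fderiv_continuousLinear_comp {M N N' : Type*} [NormedAddCommGroup M] [NormedSpace ℝ M]
    [NormedAddCommGroup N] [NormedSpace ℝ N] [NormedAddCommGroup N'] [NormedSpace ℝ N']
    (ℓ : N →L[ℝ] N') {f : M → N} {p : M}
    (hf : DifferentiableAt ℝ f p) (v : M) :
    fderiv ℝ (fun x => ℓ (f x)) p v = ℓ (fderiv ℝ f p v) := by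
  have h : HasFDerivAt (fun x => ℓ (f x)) (ℓ.comp (fderiv ℝ f p)) p :=
    ℓ.hasFDerivAt.comp p hf.hasFDerivAt
  rw [h.fderiv]; rfl

end JetCoordinates

section Frame

/-- A linear functional composed with a smooth map, as a smooth function. -/
noncomputable def coordFn {M N : Type*} [NormedAddCommGroup M] [NormedSpace ℝ M]
    [NormedAddCommGroup N] [NormedSpace ℝ N] {U : Set M} {f : M → N}
    (hf : ContDiffOn ℝ ∞ f U) (ℓ : N →L[ℝ] ℝ) : smoothFunctions U :=
  toSmooth (fun p => ℓ (f p)) (ℓ.contDiff.comp_contDiffOn hf)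

variable {M N : Type*} [NormedAddCommGroup M] [NormedSpace ℝ M]
    [NormedAddCommGroup N] [NormedSpace ℝ N] {U : Set M} {f : M → N}

lemma coordFn_apply (hf : ContDiffOn ℝ ∞ f U) (ℓ : N →L[ℝ] ℝ) (p : U) :
    (coordFn hf ℓ).1 p = ℓ (f p) := rfl

lemma fieldDerivation_coordFn (hU : IsOpen U) (ξ : M → M) (hξ : ContDiffOn ℝ ∞ ξ U)
    (hf : ContDiffOn ℝ ∞ f U) (ℓ : N →L[ℝ] ℝ) (p : U) :
    (fieldDerivation hU ξ hξ (coordFn hf ℓ)).1 p = ℓ (fderiv ℝ f p (ξ p)) := by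
  rw [coordFn, fieldDerivation_toSmooth, fderiv_continuousLinear_comp _ (smooth_differentiableAt hU hf p.2)]

end Frame

/-- The dual number valued function with the given value and the given variation. -/
noncomputable def dualFn {N : Type*} [NormedAddCommGroup N] [NormedSpace ℝ N]
    {U : Set N} {N' : Type*} [NormedAddCommGroup N'] [NormedSpace ℝ N']
    {f g : N → N'} (hf : ContDiffOn ℝ ∞ f U) (hg : ContDiffOn ℝ ∞ g U) (ℓ : N' →L[ℝ] ℝ) :
    DualNumber (smoothFunctions U) :=
  TrivSqZeroExt.inl (coordFn hf ℓ) + TrivSqZeroExt.inr (coordFn hg ℓ)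

section DualFn
variable {N : Type*} [NormedAddCommGroup N] [NormedSpace ℝ N]
    {U : Set N} {N' : Type*} [NormedAddCommGroup N'] [NormedSpace ℝ N']
    {f g : N → N'} (hf : ContDiffOn ℝ ∞ f U) (hg : ContDiffOn ℝ ∞ g U) (ℓ : N' →L[ℝ] ℝ)

@[simp] lemma fst_dualFn : (dualFn hf hg ℓ).fst = coordFn hf ℓ := by simp [dualFn]
@[simp] lemma snd_dualFn : (dualFn hf hg ℓ).snd = coordFn hg ℓ := by simp [dualFn]

end DualFn

/-- The linear map preserves the flag spanned by `∂/∂z_n` and by `∂/∂y_{m-1}, ∂/∂z_{n-1}`, as far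
as this is seen by the coordinates of lower order. -/
structure PreservesFibers {k l : ℕ}
    (L : MongeCoord (k + 1) (l + 2) →L[ℝ] MongeCoord (k + 1) (l + 2)) : Prop where
  top_x : (L (dzTop _ _)).1 = 0
  top_y : ∀ i, (L (dzTop _ _)).2.1 i = 0
  top_z : ∀ j : Fin (l + 2), (L (dzTop _ _)).2.2 j.castSucc = 0
  sub_x : (L (dySub k _)).1 = 0
  sub_y : ∀ i : Fin k, (L (dySub k _)).2.1 i.castSucc = 0
  sub_z : ∀ j : Fin (l + 1), (L (dySub k _)).2.2 j.castSucc.castSucc = 0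

namespace MongeEquation

variable {k l : ℕ} {E : MongeEquation (k + 1) (l + 2)} (hE : E.NonDegenerate)

section FrameApply
variable {N : Type*} [NormedAddCommGroup N] [NormedSpace ℝ N]
  {f : MongeCoord (k + 1) (l + 2) → N} (hf : ContDiffOn ℝ ∞ f E.dom) (ℓ : N →L[ℝ] ℝ)

lemma frame_D_coordFn (p : E.dom) : ((E.frame hE).D (coordFn hf ℓ)).1 p =
    ℓ (fderiv ℝ f p (total (E.embed p))) := fieldDerivation_coordFn E.isOpen_dom _ E.contDiffOn_total_embed _ _ _

lemma frame_Z_coordFn (p : E.dom) : ((E.frame hE).Z (coordFn hf ℓ)).1 p =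
    ℓ (fderiv ℝ f p (dzTop _ _)) := fieldDerivation_coordFn E.isOpen_dom _ contDiffOn_const _ _ _

lemma frame_Y_coordFn (p : E.dom) : ((E.frame hE).Y (coordFn hf ℓ)).1 p =
    ℓ (fderiv ℝ f p (dySub _ _)) := fieldDerivation_coordFn E.isOpen_dom _ contDiffOn_const _ _ _

lemma frame_T_coordFn (p : E.dom) : ((E.frame hE).T (coordFn hf ℓ)).1 p =
    ℓ (fderiv ℝ f p (dzSub _ _)) := fieldDerivation_coordFn E.isOpen_dom _ contDiffOn_const _ _ _

end FrameApply

lemma contact_of_map {f : MongeCoord (k + 1) (l + 2) → MixedJet (k + 1) (l + 2)}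
    (hf : ContDiffOn ℝ ∞ f E.dom)
    (h : ∀ p ∈ E.dom, ∀ w ∈ E.distribution p, fderiv ℝ f p w ∈ cartan (f p)) :
    (∀ i : Fin (k + 1), (E.frame hE).Contact (coordFn hf (jetX _ _))
      (coordFn hf (jetY _ i.castSucc)) (coordFn hf (jetY _ i.succ))) ∧
    ∀ j : Fin (l + 2), (E.frame hE).Contact (coordFn hf (jetX _ _))
      (coordFn hf (jetZ _ j.castSucc)) (coordFn hf (jetZ _ j.succ)) := by
  refine ⟨fun i => ⟨?_, ?_⟩, fun j => ⟨?_, ?_⟩⟩ <;> ext p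
  · have := (h p p.2 _ (E.total_embed_mem p.2)).1 i
    simpa [frame_D_coordFn, coordFn_apply] using this
  · have := (h p p.2 _ (E.dzTop_mem p.2)).1 i
    simpa [frame_Z_coordFn, coordFn_apply] using this
  · have := (h p p.2 _ (E.total_embed_mem p.2)).2 j
    simpa [frame_D_coordFn, coordFn_apply] using this
  · have := (h p p.2 _ (E.dzTop_mem p.2)).2 j
    simpa [frame_Z_coordFn, coordFn_apply] using this

/-- The real part is the contact relation of the embedding itself; the ε-part is its linearisation
in the direction g. -/
lemma contact_of_variation {g : MongeCoord (k + 1) (l + 2) → MixedJet (k + 1) (l + 2)}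
    (hg : ContDiffOn ℝ ∞ g E.dom)
    (h₁ : ∀ p ∈ E.dom, ∀ w ∈ E.distribution p, ∀ i : Fin (k + 1),
      (fderiv ℝ g p w).2.1 i.castSucc =
        (E.embed p).2.1 i.succ * (fderiv ℝ g p w).1 + (g p).2.1 i.succ * w.1)
    (h₂ : ∀ p ∈ E.dom, ∀ w ∈ E.distribution p, ∀ j : Fin (l + 2),
      (fderiv ℝ g p w).2.2 j.castSucc =
        (E.embed p).2.2 j.succ * (fderiv ℝ g p w).1 + (g p).2.2 j.succ * w.1) :
    (∀ i : Fin (k + 1), (E.frame hE).dual.Contact (dualFn E.contDiffOn_embed hg (jetX _ _))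
      (dualFn E.contDiffOn_embed hg (jetY _ i.castSucc))
      (dualFn E.contDiffOn_embed hg (jetY _ i.succ))) ∧
    ∀ j : Fin (l + 2), (E.frame hE).dual.Contact (dualFn E.contDiffOn_embed hg (jetX _ _))
      (dualFn E.contDiffOn_embed hg (jetZ _ j.castSucc))
      (dualFn E.contDiffOn_embed hg (jetZ _ j.succ)) := by
  obtain ⟨hy, hz⟩ := contact_of_map hE E.contDiffOn_embed fun p _ w hw => hw
  refine ⟨fun i => ⟨?_, ?_⟩, fun j => ⟨?_, ?_⟩⟩ <;> ext1
  · simpa [MongeFrame.dual] using (hy i).1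
  · ext p
    have := h₁ p p.2 _ (E.total_embed_mem p.2) i
    simpa [MongeFrame.dual, frame_D_coordFn, coordFn_apply, fderiv_embed E p.2] using this
  · simpa [MongeFrame.dual] using (hy i).2
  · ext p
    have := h₁ p p.2 _ (E.dzTop_mem p.2) i
    simpa [MongeFrame.dual, frame_Z_coordFn, coordFn_apply, fderiv_embed E p.2] using this
  · simpa [MongeFrame.dual] using (hz j).1
  · ext p
    have := h₂ p p.2 _ (E.total_embed_mem p.2) j
    simpa [MongeFrame.dual, frame_D_coordFn, coordFn_apply, fderiv_embed E p.2] using this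
  · simpa [MongeFrame.dual] using (hz j).2
  · ext p
    have := h₂ p p.2 _ (E.dzTop_mem p.2) j
    simpa [MongeFrame.dual, frame_Z_coordFn, coordFn_apply, fderiv_embed E p.2] using this

end MongeEquation

/-! ### Differentials of distribution equivalences -/

namespace IsDistributionEquiv

variable {X Y : Type*} [NormedAddCommGroup X] [NormedSpace ℝ X]
    [NormedAddCommGroup Y] [NormedSpace ℝ Y]
    {D : X → Submodule ℝ X} {D' : Y → Submodule ℝ Y} {Φ : OpenPartialHomeomorph X Y}

lemma differentiableAt (h : IsDistributionEquiv D D' Φ) {p : X} (hp : p ∈ Φ.source) :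
    DifferentiableAt ℝ Φ p :=
  smooth_differentiableAt Φ.open_source h.1 hp

lemma fderiv_symm_apply (h : IsDistributionEquiv D D' Φ) {p : X} (hp : p ∈ Φ.source) (v : X) :
    fderiv ℝ Φ.symm (Φ p) (fderiv ℝ Φ p v) = v := by
  have h1 := (h.differentiableAt hp).hasFDerivAt
  have h2 := (smooth_differentiableAt Φ.open_target h.2.1 (Φ.map_source hp)).hasFDerivAt
  have h3 : HasFDerivAt (fun x => Φ.symm (Φ x)) (ContinuousLinearMap.id ℝ X) p :=
    (hasFDerivAt_id p).congr_of_eventuallyEq (Φ.eventually_left_inverse hp)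
  exact congrArg (fun L : X →L[ℝ] X => L v) ((h2.comp p h1).unique h3)

lemma apply_fderiv_symm (h : IsDistributionEquiv D D' Φ) {p : X} (hp : p ∈ Φ.source) (v : Y) :
    fderiv ℝ Φ p (fderiv ℝ Φ.symm (Φ p) v) = v := by
  have h1 := (h.differentiableAt hp).hasFDerivAt
  have h2 := (smooth_differentiableAt Φ.open_target h.2.1 (Φ.map_source hp)).hasFDerivAt
  have h3 : HasFDerivAt (fun x => Φ (Φ.symm x)) (ContinuousLinearMap.id ℝ Y) (Φ p) :=
    (hasFDerivAt_id _).congr_of_eventuallyEq (Φ.eventually_right_inverse (Φ.map_source hp))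
  rw [← Φ.left_inv hp] at h1
  have := congrArg (fun L : Y →L[ℝ] Y => L v) ((h1.comp (Φ p) h2).unique h3)
  simpa [Φ.left_inv hp] using this

lemma injective (h : IsDistributionEquiv D D' Φ) {p : X} (hp : p ∈ Φ.source) {v : X}
    (hv : fderiv ℝ Φ p v = 0) : v = 0 := by
  rw [← h.fderiv_symm_apply hp v, hv, map_zero]

lemma mapsTo (h : IsDistributionEquiv D D' Φ) {p : X} (hp : p ∈ Φ.source) {v : X}
    (hv : v ∈ D p) : fderiv ℝ Φ p v ∈ D' (Φ p) := by
  rw [← h.2.2 p hp]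
  exact ⟨v, hv, rfl⟩

lemma surj (h : IsDistributionEquiv D D' Φ) {p : X} (hp : p ∈ Φ.source) {w : Y}
    (hw : w ∈ D' (Φ p)) : ∃ v ∈ D p, fderiv ℝ Φ p v = w := by
  rw [← h.2.2 p hp] at hw
  exact hw

lemma symm (h : IsDistributionEquiv D D' Φ) : IsDistributionEquiv D' D Φ.symm := by
  refine ⟨h.2.1, h.1, fun q hq => ?_⟩
  have hp : Φ.symm q ∈ Φ.source := Φ.map_target hq
  have hpq : Φ (Φ.symm q) = q := Φ.right_inv hq
  ext v
  constructor
  · rintro ⟨w, hw, rfl⟩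
    have hw' : w ∈ D' (Φ (Φ.symm q)) := by rw [hpq]; exact hw
    obtain ⟨u, hu, rfl⟩ := h.surj hp hw'
    have := h.fderiv_symm_apply hp u
    rw [hpq] at this
    change fderiv ℝ Φ.symm q _ ∈ _
    rwa [this]
  · intro hv
    refine ⟨fderiv ℝ Φ (Φ.symm q) v, ?_, ?_⟩
    · have := h.mapsTo hp hv
      rwa [hpq] at this
    · have := h.fderiv_symm_apply hp v
      rwa [hpq] at this

end IsDistributionEquiv

/-! ### Linear algebra of minors -/

section LinearAlgebra

/-- A functional `x` vanishes on `v` if the minors of `x, y` and `x, z` on `v, w` vanish and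
no combination of `v, w` is killed by `x, y, z`, up to a line. -/
lemma linear_eq_zero_of_minors {V : Type*} [NormedAddCommGroup V] [NormedSpace ℝ V]
    (S : Submodule ℝ V) {x y z : V →L[ℝ] ℝ} {v w e : V} (hv : v ∈ S) (hw : w ∈ S)
    (kill : ∀ u ∈ S, x u = 0 → y u = 0 → z u = 0 → ∃ r : ℝ, u = r • e)
    (hy : y v * x w = y w * x v) (hz : z v * x w = z w * x v)
    (τ : V →L[ℝ] ℝ) (τv : τ v = 0) (τw : τ w = 1) (τe : τ e = 0) : x v = 0 := by
  obtain ⟨r, hr⟩ := kill (x w • v - x v • w)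
    (S.sub_mem (S.smul_mem _ hv) (S.smul_mem _ hw)) (by simp [mul_comm])
    (by simp; linear_combination hy) (by simp; linear_combination hz)
  simpa [τv, τw, τe] using congrArg τ hr

/-- Version without the y-minor, using a third vector d. If x v ≠ 0, the combinations of v with w
and with d killed by x are also killed by z. Eliminating y between them gives a multiple of e, which
σ detects through d. -/
lemma linear_eq_zero_of_minors' {V : Type*} [NormedAddCommGroup V] [NormedSpace ℝ V]
    (S : Submodule ℝ V) {x y z : V →L[ℝ] ℝ} {v w d e : V} (hv : v ∈ S) (hw : w ∈ S) (hd : d ∈ S)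
    (kill : ∀ u ∈ S, x u = 0 → y u = 0 → z u = 0 → ∃ r : ℝ, u = r • e)
    (hz : z v * x w = z w * x v) (hz' : z v * x d = z d * x v)
    (τ : V →L[ℝ] ℝ) (τv : τ v = 0) (τw : τ w = 1) (τe : τ e = 0)
    (σ : V →L[ℝ] ℝ) (σv : σ v = 0) (σw : σ w = 0) (σd : σ d = 1) (σe : σ e = 0) :
    x v = 0 := by
  by_contra hne
  have hy : y v * x w - y w * x v ≠ 0 := fun h =>
    hne (linear_eq_zero_of_minors S hv hw kill (sub_eq_zero.1 h) hz τ τv τw τe)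
  set u := x w • v - x v • w with hu
  set u' := x d • v - x v • d with hu'
  have hyu : y u = y v * x w - y w * x v := by simp [hu]; ring
  have huS : u ∈ S := S.sub_mem (S.smul_mem _ hv) (S.smul_mem _ hw)
  have huS' : u' ∈ S := S.sub_mem (S.smul_mem _ hv) (S.smul_mem _ hd)
  have hxu : x u = 0 := by simp [hu, mul_comm]
  have hxu' : x u' = 0 := by simp [hu', mul_comm]
  have hzu : z u = 0 := by simp [hu]; linear_combination hz
  have hzu' : z u' = 0 := by simp [hu']; linear_combination hz'
  obtain ⟨r, hr⟩ := kill (y u • u' - y u' • u)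
    (S.sub_mem (S.smul_mem _ huS') (S.smul_mem _ huS)) (by simp [hxu, hxu'])
    (by simp [mul_comm]) (by simp [hzu, hzu'])
  have := congrArg σ hr
  simp [hu', hu, σv, σw, σd, σe] at this
  rcases this with h | h
  · refine hy ?_
    linear_combination h
  · exact hne h

end LinearAlgebra

/-! ### Internal equivalences preserve the fibres -/

namespace MongeEquation

/-- The internal coordinate function `x`. -/
noncomputable def coordX (m n : ℕ) : MongeCoord m n →L[ℝ] ℝ := ContinuousLinearMap.fst ℝ _ _

/-- The internal coordinate function `y_i`. -/
noncomputable def coordY (m n : ℕ) (i : Fin m) : MongeCoord m n →L[ℝ] ℝ :=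
  (ContinuousLinearMap.proj i).comp
    ((ContinuousLinearMap.fst ℝ _ _).comp (ContinuousLinearMap.snd ℝ _ _))

/-- The internal coordinate function `z_j`. -/
noncomputable def coordZ (m n : ℕ) (j : Fin (n + 1)) : MongeCoord m n →L[ℝ] ℝ :=
  (ContinuousLinearMap.proj j).comp
    ((ContinuousLinearMap.snd ℝ _ _).comp (ContinuousLinearMap.snd ℝ _ _))

lemma eq_smul_dzTop {m n : ℕ} {w : MongeCoord m n} (hx : w.1 = 0) (hy : ∀ i, w.2.1 i = 0)
    (hz : ∀ j : Fin n, w.2.2 j.castSucc = 0) : w = w.2.2 (Fin.last n) • dzTop m n := by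
  refine Prod.ext ?_ (Prod.ext ?_ ?_)
  · simp [dzTop, hx]
  · ext i; simp [dzTop, hy]
  · ext j
    refine Fin.lastCases ?_ (fun j => ?_) j
    · simp [dzTop]
    · simp [dzTop, hz, (Fin.castSucc_lt_last j).ne]

lemma eq_smul_of_mem_distribution {m n : ℕ} {E : MongeEquation m n} {p w : MongeCoord m n}
    (hp : p ∈ E.dom) (hw : w ∈ E.distribution p) (hx : w.1 = 0) :
    w = w.2.2 (Fin.last n) • dzTop m n := by
  rw [mem_distribution E hp] at hw
  refine eq_smul_dzTop hx (fun i => ?_) fun j => ?_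
  · simpa [hx] using hw.1 i
  · simpa [hx] using hw.2 j

section Equivalence

variable {k l : ℕ} {E E' : MongeEquation (k + 1) (l + 2)}
  {Ψ : OpenPartialHomeomorph (MongeCoord (k + 1) (l + 2)) (MongeCoord (k + 1) (l + 2))}

lemma IsInternalEquiv.map_mem {m n : ℕ} {E E' : MongeEquation m n}
    {Ψ : OpenPartialHomeomorph (MongeCoord m n) (MongeCoord m n)}
    (hΨ : E.IsInternalEquiv E' Ψ) {p : MongeCoord m n} (hp : p ∈ E.dom) : Ψ p ∈ E'.dom := by
  rw [← hΨ.2.1]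
  exact Ψ.map_source (by rwa [hΨ.1])

lemma IsInternalEquiv.smooth {m n : ℕ} {E E' : MongeEquation m n}
    {Ψ : OpenPartialHomeomorph (MongeCoord m n) (MongeCoord m n)}
    (hΨ : E.IsInternalEquiv E' Ψ) : ContDiffOn ℝ ∞ Ψ E.dom := by
  have := hΨ.2.2.1
  rwa [hΨ.1] at this

lemma IsInternalEquiv.symm {m n : ℕ} {E E' : MongeEquation m n}
    {Ψ : OpenPartialHomeomorph (MongeCoord m n) (MongeCoord m n)}
    (hΨ : E.IsInternalEquiv E' Ψ) : E'.IsInternalEquiv E Ψ.symm :=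
  ⟨hΨ.2.1, hΨ.1, hΨ.2.2.symm⟩

lemma IsInternalEquiv.fderiv_embed_comp {m n : ℕ} {E E' : MongeEquation m n}
    {Ψ : OpenPartialHomeomorph (MongeCoord m n) (MongeCoord m n)}
    (hΨ : E.IsInternalEquiv E' Ψ) {p : MongeCoord m n} (hp : p ∈ E.dom) :
    HasFDerivAt (fun x => E'.embed (Ψ x))
      ((fderiv ℝ E'.embed (Ψ p)).comp (fderiv ℝ Ψ p)) p :=
  (E'.hasFDerivAt_embed (hΨ.map_mem hp)).comp p
    (smooth_differentiableAt E.isOpen_dom hΨ.smooth hp).hasFDerivAt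

/-- An internal equivalence preserves the line field spanned by `∂/∂z_n` if `n > 2`. -/
lemma IsInternalEquiv.fderiv_dzTop_fst (hE : E.NonDegenerate) (hΨ : E.IsInternalEquiv E' Ψ)
    (hl : l = 0 → E.PreservesTopLine Ψ) {p : MongeCoord (k + 1) (l + 2)} (hp : p ∈ E.dom) :
    (fderiv ℝ Ψ p (dzTop _ _)).1 = 0 := by
  have hps : p ∈ Ψ.source := by rwa [hΨ.1]
  obtain rfl | ⟨l, rfl⟩ : l = 0 ∨ ∃ l', l = l' + 1 := by
    cases l
    · exact Or.inl rfl
    · exact Or.inr ⟨_, rfl⟩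
  · obtain ⟨c, hc⟩ := hl rfl p hp
    rw [hc]
    simp [dzTop]
  have hf : ContDiffOn ℝ ∞ (fun x => E'.embed (Ψ x)) E.dom :=
    E'.contDiffOn_embed.comp hΨ.smooth fun x hx => hΨ.map_mem hx
  obtain ⟨-, hz⟩ := contact_of_map hE hf fun q hq w hw => by
    rw [(hΨ.fderiv_embed_comp hq).fderiv]
    exact hΨ.2.2.mapsTo (by rwa [hΨ.1]) hw
  have h1 := hz (Fin.last l).castSucc.castSucc
  have h2 := hz (Fin.last l).castSucc.succ
  have h3 := hz (Fin.last l).succ.succ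
  -- Here n = l + 3, and the chain is z_{n-3}, z_{n-2}, z_{n-1}, z_n.
  have key := MongeFrame.Z_sq_mul_jac h1 h2 h3
  have key := congrFun (congrArg Subtype.val key) ⟨p, hp⟩
  set v := total (E.embed p)
  set L := fderiv ℝ Ψ p
  have hL : ∀ w, fderiv ℝ (fun x => E'.embed (Ψ x)) p w =
      fderiv ℝ E'.embed (Ψ p) (L w) := fun w => by
    rw [(hΨ.fderiv_embed_comp hp).fderiv]; rfl
  simp only [MongeFrame.jac, MulMemClass.coe_mul, AddSubgroupClass.coe_sub, Pi.mul_apply,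
    Pi.sub_apply, frame_Z_coordFn, frame_D_coordFn, hL, jetX_apply, jetZ_apply,
    fderiv_embed E' (hΨ.map_mem hp), joinTop_fst, joinTop_z, ZeroMemClass.coe_zero,
    Pi.zero_apply, Fin.succ_last] at key
  by_contra hne
  have hj : (L (dzTop _ _)).1 * (L v).2.2 (Fin.last _) -
      (L v).1 * (L (dzTop _ _)).2.2 (Fin.last _) = 0 := by
    have : (L (dzTop _ _)).1 * (L (dzTop _ _)).1 ≠ 0 := mul_ne_zero hne hne
    exact (mul_eq_zero.1 key).resolve_left this
  -- The image of u has zero x-component by construction, hence lies along ∂/∂z_n, and zero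
  -- z_n-component by the vanishing Jacobian. Injectivity gives u = 0, whereas the x-component of u
  -- is the one assumed non-zero.
  set u := (L (dzTop _ _)).1 • v - (L v).1 • dzTop (k + 1) (l + 1 + 2) with hu
  have huΔ : u ∈ E.distribution p :=
    Submodule.sub_mem _ (Submodule.smul_mem _ _ (E.total_embed_mem hp))
      (Submodule.smul_mem _ _ (E.dzTop_mem hp))
  have hLu := hΨ.2.2.mapsTo hps huΔ
  have h0 : (L u).1 = 0 := by simp [hu, mul_comm]
  have hLu0 := eq_smul_of_mem_distribution (hΨ.map_mem hp) hLu h0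
  have h1 : (L u).2.2 (Fin.last _) = 0 := by simpa [hu] using hj
  have hu0 : u = 0 := hΨ.2.2.injective hps (by
    change L u = 0
    rw [show L u = (L u).2.2 (Fin.last _) • dzTop _ _ from hLu0, h1, zero_smul])
  have := congrArg Prod.fst hu0
  simp [hu, v, dzTop] at this
  exact hne this

/-- The Z-part follows from Z X = 0, since the image of Z then lies along ∂/∂z_n. For the Y-part, Y
and T satisfy the lower contact relations. If Y changed x, minors would produce a vector outside the
line of Z whose image is along ∂/∂z_n, contrary to injectivity. -/
lemma IsInternalEquiv.preservesFibers (hE : E.NonDegenerate) (hΨ : E.IsInternalEquiv E' Ψ)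
    (hkl : k = 0 → 0 < l) (hl : l = 0 → E.PreservesTopLine Ψ)
    {p : MongeCoord (k + 1) (l + 2)} (hp : p ∈ E.dom) : PreservesFibers (fderiv ℝ Ψ p) := by
  have hps : p ∈ Ψ.source := by rwa [hΨ.1]
  have hf : ContDiffOn ℝ ∞ (fun x => E'.embed (Ψ x)) E.dom :=
    E'.contDiffOn_embed.comp hΨ.smooth fun x hx => hΨ.map_mem hx
  obtain ⟨hy, hz⟩ := contact_of_map hE hf fun q hq w hw => by
    rw [(hΨ.fderiv_embed_comp hq).fderiv]
    exact hΨ.2.2.mapsTo (by rwa [hΨ.1]) hw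
  set K := E.frame hE
  set L := fderiv ℝ Ψ p with hLdef
  have hL : ∀ w, fderiv ℝ (fun x => E'.embed (Ψ x)) p w =
      joinTop _ _ (L w, fderiv ℝ E'.F (Ψ p) (L w)) := fun w => by
    rw [(hΨ.fderiv_embed_comp hp).fderiv, ContinuousLinearMap.comp_apply,
      fderiv_embed E' (hΨ.map_mem hp)]
  have hZX : K.Z (coordFn hf (jetX _ _)) = 0 := by
    ext q
    rw [frame_Z_coordFn, (hΨ.fderiv_embed_comp q.2).fderiv, ContinuousLinearMap.comp_apply,
      fderiv_embed E' (hΨ.map_mem q.2)]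
    exact hΨ.fderiv_dzTop_fst hE hl q.2
  have hZx : (L (dzTop _ _)).1 = 0 := hΨ.fderiv_dzTop_fst hE hl hp
  have hLZ := eq_smul_of_mem_distribution (hΨ.map_mem hp)
    (hΨ.2.2.mapsTo hps (E.dzTop_mem hp)) hZx
  rw [← hLdef] at hLZ
  set c := (L (dzTop _ _)).2.2 (Fin.last _)
  have hc : c ≠ 0 := by
    intro h0
    rw [h0, zero_smul] at hLZ
    have h1 := congrArg (fun w : MongeCoord (k + 1) (l + 2) => w.2.2 (Fin.last _))
      (hΨ.2.2.injective hps hLZ)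
    simp [dzTop] at h1
  -- vectors killed by all lower order coordinates
  have kill : ∀ w, (L w).1 = 0 → (∀ i, (L w).2.1 i = 0) →
      (∀ j : Fin (l + 2), (L w).2.2 j.castSucc = 0) → ∃ r : ℝ, w = r • dzTop _ _ := by
    intro w hx hy hz
    refine ⟨(L w).2.2 (Fin.last _) / c, ?_⟩
    rw [← sub_eq_zero]
    refine hΨ.2.2.injective hps ?_
    rw [map_sub, map_smul, ← hLdef, hLZ, smul_smul, div_mul_cancel₀ _ hc, sub_eq_zero]
    exact eq_smul_dzTop hx hy hz
  have hYy : ∀ i : Fin k, K.Y (coordFn hf (jetY _ i.castSucc.castSucc)) =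
      coordFn hf (jetY _ i.castSucc.succ) * K.Y (coordFn hf (jetX _ _)) := fun i =>
    MongeFrame.Y_of_Z_eq_zero hZX (hy i.castSucc) (hy i.succ)
  have hYz : ∀ j : Fin (l + 1), K.Y (coordFn hf (jetZ _ j.castSucc.castSucc)) =
      coordFn hf (jetZ _ j.castSucc.succ) * K.Y (coordFn hf (jetX _ _)) := fun j =>
    MongeFrame.Y_of_Z_eq_zero hZX (hz j.castSucc) (hz j.succ)
  have hTy : ∀ i : Fin k, K.T (coordFn hf (jetY _ i.castSucc.castSucc)) =
      coordFn hf (jetY _ i.castSucc.succ) * K.T (coordFn hf (jetX _ _)) := fun i =>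
    MongeFrame.T_of_Y (hYy i) (MongeFrame.W_of_contact₂ (hy i.castSucc) (hy i.succ))
  have hTz : ∀ j : Fin (l + 1), K.T (coordFn hf (jetZ _ j.castSucc.castSucc)) =
      coordFn hf (jetZ _ j.castSucc.succ) * K.T (coordFn hf (jetX _ _)) := fun j =>
    MongeFrame.T_of_Y (hYz j) (MongeFrame.W_of_contact₂ (hz j.castSucc) (hz j.succ))
  have ev : ∀ {a b : smoothFunctions E.dom}, a = b → a.1 ⟨p, hp⟩ = b.1 ⟨p, hp⟩ :=
    fun h => by rw [h]
  -- the vectors on which the contact forms of lower order vanish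
  set θ : MongeCoord (k + 1) (l + 2) → Prop := fun w =>
    (∀ i : Fin k, (L w).2.1 i.castSucc = (E'.embed (Ψ p)).2.1 i.castSucc.succ * (L w).1) ∧
    ∀ j : Fin (l + 1), (L w).2.2 j.castSucc.castSucc =
      (E'.embed (Ψ p)).2.2 j.castSucc.succ * (L w).1 with hθ
  have hθY : θ (dySub k _) := by
    refine ⟨fun i => ?_, fun j => ?_⟩
    · simpa [K, frame_Y_coordFn, hL, coordFn_apply] using ev (hYy i)
    · simpa [K, frame_Y_coordFn, hL, coordFn_apply] using ev (hYz j)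
  have hθT : θ (dzSub _ _) := by
    refine ⟨fun i => ?_, fun j => ?_⟩
    · simpa [K, frame_T_coordFn, hL, coordFn_apply] using ev (hTy i)
    · simpa [K, frame_T_coordFn, hL, coordFn_apply] using ev (hTz j)
  have hθD : θ (total (E.embed p)) := by
    refine ⟨fun i => ?_, fun j => ?_⟩
    · simpa [K, frame_D_coordFn, hL, coordFn_apply] using ev (hy i.castSucc).1
    · simpa [K, frame_D_coordFn, hL, coordFn_apply] using ev (hz j.castSucc).1
  set S : Submodule ℝ (MongeCoord (k + 1) (l + 2)) :=
    { carrier := {w | θ w}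
      zero_mem' := by simp [hθ]
      add_mem' := by
        rintro v w ⟨h1, h2⟩ ⟨h3, h4⟩
        refine ⟨fun i => ?_, fun j => ?_⟩
        · simp [h1, h3, mul_add]
        · simp [h2, h4, mul_add]
      smul_mem' := by
        rintro a v ⟨h1, h2⟩
        refine ⟨fun i => ?_, fun j => ?_⟩
        · simp [h1, mul_left_comm]
        · simp [h2, mul_left_comm] } with hS
  have killθ : ∀ w ∈ S, (coordX _ _ ∘L L) w = 0 → (coordY _ _ (Fin.last k) ∘L L) w = 0 → (coordZ _ _ (Fin.last (l + 1)).castSucc ∘L L) w = 0 →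
      ∃ r : ℝ, w = r • dzTop _ _ := by
    intro w hw hx hy hz
    refine kill w hx (fun i => ?_) fun j => ?_
    · refine Fin.lastCases hy (fun i => ?_) i
      rw [hw.1, show (L w).1 = 0 from hx, mul_zero]
    · refine Fin.lastCases hz (fun j => ?_) j
      rw [hw.2, show (L w).1 = 0 from hx, mul_zero]
  have mZ : (coordZ _ _ (Fin.last (l + 1)).castSucc ∘L L) (dySub k _) * (coordX _ _ ∘L L) (dzSub _ _) =
      (coordZ _ _ (Fin.last (l + 1)).castSucc ∘L L) (dzSub _ _) * (coordX _ _ ∘L L) (dySub k _) := by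
    have := ev (MongeFrame.YT_minor (hYz (Fin.last l)) (hTz (Fin.last l)))
    simp only [K, MulMemClass.coe_mul, Pi.mul_apply, frame_Y_coordFn, frame_T_coordFn, hL,
      jetZ_apply, jetX_apply, joinTop_z, joinTop_fst] at this
    exact this
  have hYx : (coordX _ _ ∘L L) (dySub k _) = 0 := by
    obtain rfl | ⟨k, rfl⟩ : k = 0 ∨ ∃ k', k = k' + 1 := by
      cases k
      · exact Or.inl rfl
      · exact Or.inr ⟨_, rfl⟩
    · obtain ⟨l, rfl⟩ := Nat.exists_eq_add_one.2 (hkl rfl)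
      -- For m = 1 the only internal y-coordinate is y_0, so there is no y-minor on (Y, T). The
      -- z_{n-1}-minors on (Y, T) and (Y, D) are used instead.
      have mD := ev (MongeFrame.YD_minor_of_comm_YD (frame_comm_YD E hE) hZX
        (hz (Fin.last (l + 1)).castSucc) (hz (Fin.last (l + 1)).succ))
      simp only [MulMemClass.coe_mul, Pi.mul_apply, frame_Y_coordFn, frame_D_coordFn, hL,
        jetZ_apply, jetX_apply, joinTop_z, joinTop_fst] at mD
      refine linear_eq_zero_of_minors' S hθY hθT hθD killθ mZ mD
        (coordZ _ _ (Fin.last (l + 1 + 1)).castSucc) ?_ ?_ ?_ (coordX _ _)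
        ?_ ?_ ?_ ?_
      all_goals simp [dySub, dzSub, dzTop, coordX, coordZ, Fin.ext_iff]
    -- For m ≥ 2 the minors of y_{m-1} and z_{n-1} on (Y, T) suffice.
    · have mY := ev (MongeFrame.YT_minor (hYy (Fin.last k)) (hTy (Fin.last k)))
      have mY : (coordY _ _ (Fin.last (k + 1)) ∘L L) (dySub (k + 1) _) * (coordX _ _ ∘L L) (dzSub _ _) =
          (coordY _ _ (Fin.last (k + 1)) ∘L L) (dzSub _ _) * (coordX _ _ ∘L L) (dySub (k + 1) _) := by
        simp only [K, MulMemClass.coe_mul, Pi.mul_apply, frame_Y_coordFn, frame_T_coordFn, hL,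
          jetY_apply, jetX_apply, joinTop_y, joinTop_fst, Fin.succ_castSucc, Fin.snoc_castSucc]
          at mY
        exact mY
      refine linear_eq_zero_of_minors S hθY hθT killθ mY mZ
        (coordZ _ _ (Fin.last (l + 1)).castSucc) ?_ ?_ ?_
      all_goals simp [dySub, dzSub, dzTop, coordZ, Fin.ext_iff]
  have hYx' : (L (dySub k _)).1 = 0 := hYx
  refine ⟨hZx, fun i => ?_, fun j => ?_, hYx, fun i => ?_, fun j => ?_⟩
  · rw [hLZ]; simp [dzTop]
  · rw [hLZ]; simp [dzTop, (Fin.castSucc_lt_last j).ne]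
  · rw [hθY.1, hYx', mul_zero]
  · rw [hθY.2, hYx', mul_zero]

end Equivalence

end MongeEquation

/-! ### Infinitesimal symmetries preserve the fibres -/

lemma isInfinitesimalSymmetry_cartan_iff {m n : ℕ} {O : Set (MixedJet m n)} (hO : IsOpen O)
    {V : MixedJet m n → MixedJet m n} :
    IsInfinitesimalSymmetry cartan O V ↔ ContDiffOn ℝ ∞ V O ∧ ∀ q ∈ O, ∀ v ∈ cartan q,
      (∀ i : Fin m, (fderiv ℝ V q v).2.1 i.castSucc =
        q.2.1 i.succ * (fderiv ℝ V q v).1 + (V q).2.1 i.succ * v.1) ∧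
      ∀ j : Fin n, (fderiv ℝ V q v).2.2 j.castSucc =
        q.2.2 j.succ * (fderiv ℝ V q v).1 + (V q).2.2 j.succ * v.1 := by
  rw [isInfinitesimalSymmetry_iff hO (ι := Fin m ⊕ Fin n)
    (ℓ := Sum.elim (fun i => jetY n i.castSucc) fun j => jetZ m j.castSucc) (ℓ₀ := jetX m n)
    (c := Sum.elim (fun i => jetY n i.succ) fun j => jetZ m j.succ)
    (e := Sum.elim (fun i => (0, Pi.single i.castSucc 1, 0)) fun j =>
      (0, 0, Pi.single j.castSucc 1))]
  · simp only [Sum.forall, Sum.elim_inl, Sum.elim_inr, jetX_apply, jetY_apply, jetZ_apply,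
      ContinuousLinearMap.fderiv]
  · rintro (i | j)
    · exact (jetY n i.succ).contDiff.contDiffOn
    · exact (jetZ m j.succ).contDiff.contDiffOn
  · intro p _ v
    simp only [Sum.forall, Sum.elim_inl, Sum.elim_inr, jetX_apply, jetY_apply, jetZ_apply]
    rfl
  · rintro (i | j) (i' | j') <;> simp [Pi.single_apply]
  · rintro (i | j) <;> simp

namespace MongeEquation

lemma isInternalSymmetry_iff {m n : ℕ} {E : MongeEquation m n}
    {X : MongeCoord m n → MongeCoord m n} :
    E.IsInternalSymmetry X ↔ ContDiffOn ℝ ∞ X E.dom ∧ ∀ p ∈ E.dom, ∀ w ∈ E.distribution p,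
      (∀ i : Fin m, (fderiv ℝ X p w).2.1 i =
        (E.embed p).2.1 i.succ * (fderiv ℝ X p w).1 +
          (fderiv ℝ E.embed p (X p)).2.1 i.succ * w.1) ∧
      ∀ j : Fin n, (fderiv ℝ X p w).2.2 j.castSucc =
        p.2.2 j.succ * (fderiv ℝ X p w).1 + (X p).2.2 j.succ * w.1 := by
  rw [IsInternalSymmetry, isInfinitesimalSymmetry_iff E.isOpen_dom (ι := Fin m ⊕ Fin n)
    (ℓ := Sum.elim (fun i => coordY m n i) fun j => coordZ m n j.castSucc) (ℓ₀ := coordX m n)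
    (c := Sum.elim (fun i p => jetY n i.succ (E.embed p)) fun j => coordZ m n j.succ)
    (e := Sum.elim (fun i => (0, Pi.single i 1, 0)) fun j =>
      (0, 0, Pi.single j.castSucc 1))]
  · refine and_congr_right fun _ => forall₂_congr fun p hp => forall₂_congr fun w _ => ?_
    simp only [Sum.forall, Sum.elim_inl, Sum.elim_inr, ContinuousLinearMap.fderiv]
    refine and_congr (forall_congr' fun i => ?_) Iff.rfl
    rw [fderiv_continuousLinear_comp _
      (smooth_differentiableAt E.isOpen_dom E.contDiffOn_embed hp)]
    rfl
  · rintro (i | j)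
    · exact (jetY n i.succ).contDiff.comp_contDiffOn E.contDiffOn_embed
    · exact (coordZ m n j.succ).contDiff.contDiffOn
  · intro p hp v
    rw [mem_distribution E hp]
    simp only [Sum.forall, Sum.elim_inl, Sum.elim_inr]
    rfl
  · rintro (i | j) (i' | j') <;> simp [Pi.single_apply, coordY, coordZ]
  · rintro (i | j) <;> simp [coordX]

/-- The vector field on the jet space along the equation defined by an internal vector field. -/
noncomputable def pushField {m n : ℕ} (E : MongeEquation m n)
    (X : MongeCoord m n → MongeCoord m n) (p : MongeCoord m n) : MixedJet m n :=
  fderiv ℝ E.embed p (X p)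

lemma contDiffOn_pushField {m n : ℕ} {E : MongeEquation m n}
    {X : MongeCoord m n → MongeCoord m n} (hX : ContDiffOn ℝ ∞ X E.dom) :
    ContDiffOn ℝ ∞ (E.pushField X) E.dom :=
  contDiffOn_fderiv_apply E.isOpen_dom E.contDiffOn_embed hX

lemma forgetTop_fderiv_pushField {m n : ℕ} {E : MongeEquation m n}
    {X : MongeCoord m n → MongeCoord m n} (hX : ContDiffOn ℝ ∞ X E.dom)
    {p : MongeCoord m n} (hp : p ∈ E.dom) (w : MongeCoord m n) :
    forgetTop m n (fderiv ℝ (E.pushField X) p w) = fderiv ℝ X p w := by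
  rw [← fderiv_continuousLinear_comp _
    (smooth_differentiableAt E.isOpen_dom (contDiffOn_pushField hX) hp)]
  have : (fun x => forgetTop m n (E.pushField X x)) =ᶠ[𝓝 p] X :=
    Filter.eventuallyEq_of_mem (E.isOpen_dom.mem_nhds hp) fun x hx =>
      forgetTop_fderiv_embed E hx _
  rw [this.fderiv_eq]

section Symmetry

variable {k l : ℕ} {E : MongeEquation (k + 1) (l + 2)} (hE : E.NonDegenerate)

lemma fderiv_pushField_fst {m n : ℕ} {E : MongeEquation m n}
    {X : MongeCoord m n → MongeCoord m n} (hX : ContDiffOn ℝ ∞ X E.dom)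
    {p : MongeCoord m n} (hp : p ∈ E.dom) (w : MongeCoord m n) :
    (fderiv ℝ (E.pushField X) p w).1 = (fderiv ℝ X p w).1 :=
  congrArg Prod.fst (forgetTop_fderiv_pushField hX hp w)

lemma fderiv_pushField_y {m n : ℕ} {E : MongeEquation m n}
    {X : MongeCoord m n → MongeCoord m n} (hX : ContDiffOn ℝ ∞ X E.dom)
    {p : MongeCoord m n} (hp : p ∈ E.dom) (w : MongeCoord m n) (i : Fin m) :
    (fderiv ℝ (E.pushField X) p w).2.1 i.castSucc = (fderiv ℝ X p w).2.1 i :=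
  congrArg (fun v : MongeCoord m n => v.2.1 i) (forgetTop_fderiv_pushField hX hp w)

lemma fderiv_pushField_z {m n : ℕ} {E : MongeEquation m n}
    {X : MongeCoord m n → MongeCoord m n} (hX : ContDiffOn ℝ ∞ X E.dom)
    {p : MongeCoord m n} (hp : p ∈ E.dom) (w : MongeCoord m n) :
    (fderiv ℝ (E.pushField X) p w).2.2 = (fderiv ℝ X p w).2.2 :=
  congrArg (fun v : MongeCoord m n => v.2.2) (forgetTop_fderiv_pushField hX hp w)

lemma pushField_z {m n : ℕ} {E : MongeEquation m n}
    {X : MongeCoord m n → MongeCoord m n}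
    {p : MongeCoord m n} (hp : p ∈ E.dom) : (E.pushField X p).2.2 = (X p).2.2 :=
  congrArg (fun v : MongeCoord m n => v.2.2) (forgetTop_fderiv_embed E hp (X p))

/-- Passing to the dual numbers lets the commutator identities for contact maps apply to vector
fields. -/
lemma IsInternalSymmetry.contact {X : MongeCoord (k + 1) (l + 2) → MongeCoord (k + 1) (l + 2)}
    (hX : E.IsInternalSymmetry X) :
    (∀ i : Fin (k + 1), (E.frame hE).dual.Contact
      (dualFn E.contDiffOn_embed (contDiffOn_pushField hX.1) (jetX _ _))
      (dualFn E.contDiffOn_embed (contDiffOn_pushField hX.1) (jetY _ i.castSucc))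
      (dualFn E.contDiffOn_embed (contDiffOn_pushField hX.1) (jetY _ i.succ))) ∧
    ∀ j : Fin (l + 2), (E.frame hE).dual.Contact
      (dualFn E.contDiffOn_embed (contDiffOn_pushField hX.1) (jetX _ _))
      (dualFn E.contDiffOn_embed (contDiffOn_pushField hX.1) (jetZ _ j.castSucc))
      (dualFn E.contDiffOn_embed (contDiffOn_pushField hX.1) (jetZ _ j.succ)) := by
  have h := (isInternalSymmetry_iff.1 hX).2
  refine contact_of_variation hE _ (fun p hp w hw i => ?_) fun p hp w hw j => ?_
  · rw [fderiv_pushField_y hX.1 hp, fderiv_pushField_fst hX.1 hp]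
    exact (h p hp w hw).1 i
  · rw [fderiv_pushField_z hX.1 hp, fderiv_pushField_fst hX.1 hp, pushField_z hp]
    exact (h p hp w hw).2 j

section FrameValues

lemma frame_Z_x : (E.frame hE).Z (coordFn E.contDiffOn_embed (jetX _ _)) = 0 := by
  ext p; rw [frame_Z_coordFn, fderiv_embed E p.2]; simp [dzTop]

lemma frame_Y_x : (E.frame hE).Y (coordFn E.contDiffOn_embed (jetX _ _)) = 0 := by
  ext p; rw [frame_Y_coordFn, fderiv_embed E p.2]; simp [dySub]

lemma frame_T_x : (E.frame hE).T (coordFn E.contDiffOn_embed (jetX _ _)) = 0 := by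
  ext p; rw [frame_T_coordFn, fderiv_embed E p.2]; simp [dzSub]

lemma frame_D_x : (E.frame hE).D (coordFn E.contDiffOn_embed (jetX _ _)) = 1 := by
  ext p; rw [frame_D_coordFn, fderiv_embed E p.2]; simp

lemma frame_Z_z : (E.frame hE).Z (coordFn E.contDiffOn_embed (jetZ _ (Fin.last _))) = 1 := by
  ext p; rw [frame_Z_coordFn, fderiv_embed E p.2]; simp [dzTop]

lemma frame_Z_y : (E.frame hE).Z (coordFn E.contDiffOn_embed (jetY _ (Fin.last _))) =
    (E.frame hE).Fz := by
  ext p; rw [frame_Z_coordFn, fderiv_embed E p.2]; simp [frame]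

lemma frame_Y_z : (E.frame hE).Y
    (coordFn E.contDiffOn_embed (jetZ _ (Fin.last (l + 1)).castSucc)) = 0 := by
  ext p; rw [frame_Y_coordFn, fderiv_embed E p.2]; simp [dySub]

lemma frame_T_z : (E.frame hE).T
    (coordFn E.contDiffOn_embed (jetZ _ (Fin.last (l + 1)).castSucc)) = 1 := by
  ext p; rw [frame_T_coordFn, fderiv_embed E p.2]; simp [dzSub]

end FrameValues

/-- The line field spanned by `∂/∂z_n` is invariant under internal symmetries. -/
lemma IsInternalSymmetry.dual_Z_x_eq_zero
    {X : MongeCoord (k + 1) (l + 2) → MongeCoord (k + 1) (l + 2)}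
    (hX : E.IsInternalSymmetry X) (hkl : k = 0 → 0 < l) :
    (E.frame hE).dual.Z
      (dualFn E.contDiffOn_embed (contDiffOn_pushField hX.1) (jetX _ _)) = 0 := by
  obtain ⟨hy, hz⟩ := hX.contact hE
  obtain rfl | ⟨k, rfl⟩ : k = 0 ∨ ∃ k', k = k' + 1 := by
    cases k
    · exact Or.inl rfl
    · exact Or.inr ⟨_, rfl⟩
  · obtain ⟨l, rfl⟩ := Nat.exists_eq_add_one.2 (hkl rfl)
    -- For m = 1 the excluded pairs force n ≥ 3, so the chain z_{n-3}, …, z_n exists.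
    refine MongeFrame.dual_Z_eq_zero_of_comm_YD (frame_comm_YD E hE)
      (hz (Fin.last l).castSucc.castSucc) (hz (Fin.last l).castSucc.succ)
      (hz (Fin.last l).succ.succ) ?_ ?_ ?_ <;> rw [fst_dualFn]
    · exact frame_D_x hE
    · exact frame_Z_x hE
    · exact frame_Z_z hE
  -- For m ≥ 2 the chains from y_{m-2} to y_m and from z_{n-2} to z_n are used; real-valued
  -- functions have no 2-torsion.
  · refine MongeFrame.dual_Z_eq_zero (fun a ha => ?_)
      (hy (Fin.last k).castSucc) (hy (Fin.last k).succ)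
      (hz (Fin.last l).castSucc) (hz (Fin.last l).succ) ?_ ?_ ?_ ?_ ?_ ?_
    · ext p
      rw [two_mul] at ha
      have : a.1 p + a.1 p = 0 := congrFun (congrArg Subtype.val ha) p
      change a.1 p = 0
      linarith
    all_goals rw [fst_dualFn]
    · exact frame_D_x hE
    · exact frame_Z_x hE
    · exact frame_Y_x hE
    · exact frame_T_x hE
    · exact frame_Z_y hE
    · exact frame_Z_z hE

lemma IsInternalSymmetry.preservesFibers
    {X : MongeCoord (k + 1) (l + 2) → MongeCoord (k + 1) (l + 2)} (hE : E.NonDegenerate)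
    (hX : E.IsInternalSymmetry X) (hkl : k = 0 → 0 < l)
    {p : MongeCoord (k + 1) (l + 2)} (hp : p ∈ E.dom) : PreservesFibers (fderiv ℝ X p) := by
  obtain ⟨hy, hz⟩ := hX.contact hE
  have hZX := hX.dual_Z_x_eq_zero hE hkl
  have hYX : (E.frame hE).dual.Y
      (dualFn E.contDiffOn_embed (contDiffOn_pushField hX.1) (jetX _ _)) = 0 := by
    refine MongeFrame.dual_Y_eq_zero hZX (hz (Fin.last l).castSucc) (hz (Fin.last l).succ)
      ?_ ?_ ?_ ?_ <;> rw [fst_dualFn]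
    · exact frame_Y_x hE
    · exact frame_T_x hE
    · exact frame_Y_z hE
    · exact frame_T_z hE
  have ev : ∀ {a : DualNumber (smoothFunctions E.dom)}, a = 0 → a.snd.1 ⟨p, hp⟩ = 0 :=
    fun h => by rw [h]; rfl
  have evZ : ∀ {ℓ : MixedJet (k + 1) (l + 2) →L[ℝ] ℝ}, (E.frame hE).dual.Z
      (dualFn E.contDiffOn_embed (contDiffOn_pushField hX.1) ℓ) = 0 →
      ℓ (fderiv ℝ (E.pushField X) p (dzTop _ _)) = 0 := fun h => by
    simpa [MongeFrame.dual, frame_Z_coordFn] using ev h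
  have evY : ∀ {ℓ : MixedJet (k + 1) (l + 2) →L[ℝ] ℝ}, (E.frame hE).dual.Y
      (dualFn E.contDiffOn_embed (contDiffOn_pushField hX.1) ℓ) = 0 →
      ℓ (fderiv ℝ (E.pushField X) p (dySub _ _)) = 0 := fun h => by
    simpa [MongeFrame.dual, frame_Y_coordFn] using ev h
  refine ⟨?_, fun i => ?_, fun j => ?_, ?_, fun i => ?_, fun j => ?_⟩
  · rw [← fderiv_pushField_fst hX.1 hp]
    exact evZ hZX
  · rw [← fderiv_pushField_y hX.1 hp]
    exact evZ (ℓ := jetY _ _) (by rw [(hy i).2, hZX, mul_zero])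
  · rw [← fderiv_pushField_z hX.1 hp]
    exact evZ (ℓ := jetZ _ _) (by rw [(hz j).2, hZX, mul_zero])
  · rw [← fderiv_pushField_fst hX.1 hp]
    exact evY hYX
  · rw [← fderiv_pushField_y hX.1 hp]
    exact evY (ℓ := jetY _ _) (by
      rw [MongeFrame.Y_of_Z_eq_zero hZX (hy i.castSucc) (hy i.succ), hYX, mul_zero])
  · rw [← fderiv_pushField_z hX.1 hp]
    exact evY (ℓ := jetZ _ _) (by
      rw [MongeFrame.Y_of_Z_eq_zero hZX (hz j.castSucc) (hz j.succ), hYX, mul_zero])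

end Symmetry

end MongeEquation

/-! ### Constancy along segments -/

section Segments

/-- A function is constant along a segment if its derivative along the segment vanishes. -/
lemma eq_of_fderiv_apply_eq_zero {N N' : Type*} [NormedAddCommGroup N] [NormedSpace ℝ N]
    [NormedAddCommGroup N'] [NormedSpace ℝ N'] {f : N → N'} {q v : N}
    (hf : ∀ t ∈ Set.Icc (0 : ℝ) 1, DifferentiableAt ℝ f (q + t • v))
    (h : ∀ t ∈ Set.Icc (0 : ℝ) 1, fderiv ℝ f (q + t • v) v = 0) : f (q + v) = f q := by
  have hg : ∀ t ∈ Set.Icc (0 : ℝ) 1, HasDerivAt (fun t : ℝ => f (q + t • v)) 0 t := by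
    intro t ht
    have h1 : HasDerivAt (fun t : ℝ => q + t • v) v t := by
      simpa using ((hasDerivAt_id t).smul_const v).const_add q
    have := (hf t ht).hasFDerivAt.comp_hasDerivAt t h1
    rwa [h t ht] at this
  have := constant_of_has_deriv_right_zero (f := fun t : ℝ => f (q + t • v)) (a := 0) (b := 1)
    (fun t ht => (hg t ht).continuousAt.continuousWithinAt)
    (fun t ht => (hg t ⟨ht.1, ht.2.le⟩).hasDerivWithinAt) 1 (by simp)
  simpa using this

end Segments

/-! ### Lower order components determine the top ones -/

section Lower

variable {m n : ℕ}

/-- The projection of the internal coordinates forgetting `z_n`. -/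
noncomputable def lowerCoord (m n : ℕ) :
    MongeCoord m n →L[ℝ] ℝ × (Fin m → ℝ) × (Fin n → ℝ) :=
  LinearMap.toContinuousLinearMap
    { toFun := fun q => (q.1, q.2.1, Fin.init q.2.2)
      map_add' := fun _ _ => rfl
      map_smul' := fun _ _ => rfl }

lemma lowerCoord_apply (w : MongeCoord m n) :
    lowerCoord m n w = (w.1, w.2.1, Fin.init w.2.2) := rfl

lemma lowerCoord_eq_iff {w w' : MongeCoord m n} : lowerCoord m n w = lowerCoord m n w' ↔
    w.1 = w'.1 ∧ (∀ i, w.2.1 i = w'.2.1 i) ∧ ∀ j : Fin n, w.2.2 j.castSucc = w'.2.2 j.castSucc := by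
  simp only [lowerCoord_apply, Prod.mk.injEq, funext_iff, Fin.init]

@[simp] lemma lowerCoord_dzTop : lowerCoord m n (dzTop m n) = 0 := by
  rw [← map_zero (lowerCoord m n), lowerCoord_eq_iff]
  simp [dzTop, (Fin.castSucc_lt_last _).ne]

/-- The projection of the jet space forgetting `y_m` and `z_n`. -/
noncomputable def lowerJet (m n : ℕ) :
    MixedJet m n →L[ℝ] ℝ × (Fin m → ℝ) × (Fin n → ℝ) :=
  (lowerCoord m n).comp (forgetTop m n)

lemma lowerJet_apply (q : MixedJet m n) :
    lowerJet m n q = lowerCoord m n (forgetTop m n q) := rfl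

lemma lowerJet_eq_iff {v v' : MixedJet m n} : lowerJet m n v = lowerJet m n v' ↔
    v.1 = v'.1 ∧ (∀ i : Fin m, v.2.1 i.castSucc = v'.2.1 i.castSucc) ∧
      ∀ j : Fin n, v.2.2 j.castSucc = v'.2.2 j.castSucc := by
  rw [lowerJet_apply, lowerJet_apply, lowerCoord_eq_iff]
  rfl

/-- The coordinate vector field `∂/∂y_m` on the jet space. -/
noncomputable def jetDy (m n : ℕ) : MixedJet m n := joinTop m n (0, 1)

/-- The coordinate vector field `∂/∂z_n` on the jet space. -/
noncomputable def jetDz (m n : ℕ) : MixedJet m n := joinTop m n (dzTop m n, 0)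

/-- The total derivative as a tangent vector of the jet space. -/
noncomputable def jetTotal (q : MixedJet m n) : MixedJet m n := joinTop m n (total q, 0)

lemma jetDy_mem (q : MixedJet m n) : jetDy m n ∈ cartan q := by
  simp [mem_cartan, jetDy]

lemma jetDz_mem (q : MixedJet m n) : jetDz m n ∈ cartan q := by
  simp [mem_cartan, jetDz, dzTop, (Fin.castSucc_lt_last _).ne]

lemma jetTotal_mem (q : MixedJet m n) : jetTotal q ∈ cartan q := by
  simp [mem_cartan, jetTotal]

@[simp] lemma jetTotal_fst (q : MixedJet m n) : (jetTotal q).1 = 1 := by simp [jetTotal]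

lemma add_smul_jetDy (p : MongeCoord m n) (s t : ℝ) :
    joinTop m n (p, s) + t • jetDy m n = joinTop m n (p, s + t) := by
  rw [jetDy, ← map_smul, ← map_add]
  simp

lemma eq_zero_of_mem_cartan {q v : MixedJet m n} (hv : v ∈ cartan q) (hx : v.1 = 0)
    (hy : v.2.1 (Fin.last m) = 0) (hz : v.2.2 (Fin.last n) = 0) : v = 0 := by
  refine Prod.ext hx (Prod.ext ?_ ?_)
  · ext i
    refine Fin.lastCases hy (fun i => ?_) i
    simp [hv.1, hx]
  · ext i
    refine Fin.lastCases hz (fun i => ?_) i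
    simp [hv.2, hx]

lemma lowerJet_eq_zero_of_mem_cartan {q v : MixedJet m n} (hv : v ∈ cartan q) (hx : v.1 = 0) :
    lowerJet m n v = 0 := by
  rw [← map_zero (lowerJet m n), lowerJet_eq_iff]
  refine ⟨hx, fun i => ?_, fun j => ?_⟩
  · simp [hv.1, hx]
  · simp [hv.2, hx]

/-- Maps preserving the contact forms are determined by their lower order components. -/
lemma eq_of_lowerJet_eventuallyEq {k l : ℕ}
    {f g : MixedJet (k + 1) (l + 1) → MixedJet (k + 1) (l + 1)}
    {q : MixedJet (k + 1) (l + 1)} (hf : DifferentiableAt ℝ f q) (hg : DifferentiableAt ℝ g q)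
    (h : (fun x => lowerJet _ _ (f x)) =ᶠ[𝓝 q] fun x => lowerJet _ _ (g x))
    (hfC : fderiv ℝ f q (jetTotal q) ∈ cartan (f q))
    (hgC : fderiv ℝ g q (jetTotal q) ∈ cartan (g q))
    (hne : (fderiv ℝ f q (jetTotal q)).1 ≠ 0) : f q = g q := by
  have h0 := h.eq_of_nhds
  have h1 := congrArg (fun L : MixedJet (k + 1) (l + 1) →L[ℝ] ℝ × (Fin (k + 1) → ℝ) × (Fin (l + 1) → ℝ) =>
    L (jetTotal q)) h.fderiv_eq
  simp only [fderiv_continuousLinear_comp _ hf, fderiv_continuousLinear_comp _ hg] at h1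
  rw [lowerJet_eq_iff] at h0 h1
  refine Prod.ext h0.1 (Prod.ext ?_ ?_)
  · ext i
    refine Fin.lastCases ?_ h0.2.1 i
    have e1 := hfC.1 (Fin.last k)
    have e2 := hgC.1 (Fin.last k)
    have e3 := h1.2.1 (Fin.last k)
    rw [Fin.succ_last] at e1 e2
    -- The value of y_m is the derivative of y_{m-1} divided by that of x along the total
    -- derivative, and both derivatives are determined by the lower components.
    refine mul_right_cancel₀ hne ?_
    rw [← e1, e3, e2, h1.1]
  · ext j
    refine Fin.lastCases ?_ h0.2.2 j
    have e1 := hfC.2 (Fin.last l)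
    have e2 := hgC.2 (Fin.last l)
    have e3 := h1.2.2 (Fin.last l)
    rw [Fin.succ_last] at e1 e2
    refine mul_right_cancel₀ hne ?_
    rw [← e1, e3, e2, h1.1]

/-- Infinitesimal Lie transformations are determined by their lower order components. -/
lemma eq_of_lowerJet_eventuallyEq_field {k l : ℕ} {O : Set (MixedJet (k + 1) (l + 1))}
    {O' : Set (MixedJet (k + 1) (l + 1))} (hO : IsOpen O) (hO' : IsOpen O')
    {V V' : MixedJet (k + 1) (l + 1) → MixedJet (k + 1) (l + 1)}
    (hV : IsInfinitesimalSymmetry cartan O V) (hV' : IsInfinitesimalSymmetry cartan O' V')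
    {q : MixedJet (k + 1) (l + 1)} (hq : q ∈ O) (hq' : q ∈ O')
    (h : (fun x => lowerJet _ _ (V x)) =ᶠ[𝓝 q] fun x => lowerJet _ _ (V' x)) : V q = V' q := by
  have h0 := h.eq_of_nhds
  have h1 := congrArg (fun L : MixedJet (k + 1) (l + 1) →L[ℝ] ℝ × (Fin (k + 1) → ℝ) × (Fin (l + 1) → ℝ) =>
    L (jetTotal q)) h.fderiv_eq
  simp only [fderiv_continuousLinear_comp _ (smooth_differentiableAt hO hV.1 hq),
    fderiv_continuousLinear_comp _ (smooth_differentiableAt hO' hV'.1 hq')] at h1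
  rw [lowerJet_eq_iff] at h0 h1
  have hC := ((isInfinitesimalSymmetry_cartan_iff hO).1 hV).2 q hq _ (jetTotal_mem q)
  have hC' := ((isInfinitesimalSymmetry_cartan_iff hO').1 hV').2 q hq' _ (jetTotal_mem q)
  refine Prod.ext h0.1 (Prod.ext ?_ ?_)
  · ext i
    refine Fin.lastCases ?_ h0.2.1 i
    have e1 := hC.1 (Fin.last k)
    have e2 := hC'.1 (Fin.last k)
    rw [Fin.succ_last, jetTotal_fst, mul_one, h1.2.1, h1.1] at e1
    rw [Fin.succ_last, jetTotal_fst, mul_one] at e2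
    linarith
  · ext j
    refine Fin.lastCases ?_ h0.2.2 j
    have e1 := hC.2 (Fin.last l)
    have e2 := hC'.2 (Fin.last l)
    rw [Fin.succ_last, jetTotal_fst, mul_one, h1.2.2, h1.1] at e1
    rw [Fin.succ_last, jetTotal_fst, mul_one] at e2
    linarith

end Lower

/-! ### Lie transformations do not mix y_m into lower components -/

section LieTransformation

variable {k l : ℕ}

lemma minors_of_contact {R A : Type*} [CommRing R] [CommRing A] [Algebra R A]
    {V₁ V₂ : Derivation R A A} (hV : ∀ g, V₁ (V₂ g) = V₂ (V₁ g)) {x P P' : DualNumber A}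
    (h₁ : dualDerivation V₁ P = P' * dualDerivation V₁ x)
    (h₂ : dualDerivation V₂ P = P' * dualDerivation V₂ x) :
    dualDerivation V₁ P' * dualDerivation V₂ x = dualDerivation V₂ P' * dualDerivation V₁ x := by
  refine derivation_minor (fun g => ?_) h₁ h₂
  ext1 <;> simp [hV]

/-- The fields ∂/∂y_m and ∂/∂z_n commute and are Cartan, so the minors of y_m and of z_n with x
vanish on them. The combination whose image has no x-component is therefore mapped to zero, and
injectivity makes its coefficients vanish. -/
lemma fderiv_jetDy_of_contact {O : Set (MixedJet (k + 1) (l + 1))} (hO : IsOpen O)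
    {f : MixedJet (k + 1) (l + 1) → MixedJet (k + 1) (l + 1)} (hf : ContDiffOn ℝ ∞ f O)
    (hC : ∀ q ∈ O, ∀ v ∈ cartan q, fderiv ℝ f q v ∈ cartan (f q))
    (hinj : ∀ q ∈ O, ∀ v, fderiv ℝ f q v = 0 → v = 0) {q : MixedJet (k + 1) (l + 1)}
    (hq : q ∈ O) :
    (fderiv ℝ f q (jetDy _ _)).1 = 0 ∧ (fderiv ℝ f q (jetDz _ _)).1 = 0 := by
  set V₁ := fieldDerivation hO (fun _ => jetDy (k + 1) (l + 1)) contDiffOn_const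
  set V₂ := fieldDerivation hO (fun _ => jetDz (k + 1) (l + 1)) contDiffOn_const
  have hV : ∀ g, V₁ (V₂ g) = V₂ (V₁ g) := fieldDerivation_const_comm_const hO _ _
  have my := derivation_minor hV (X := coordFn hf (jetX _ _))
    (P := coordFn hf (jetY _ (Fin.last k).castSucc))
    (P' := coordFn hf (jetY _ (Fin.last k).succ))
    (by
      ext p
      simpa [V₁, fieldDerivation_coordFn, coordFn_apply] using
        (hC p p.2 _ (jetDy_mem _)).1 (Fin.last k))
    (by
      ext p
      simpa [V₂, fieldDerivation_coordFn, coordFn_apply] using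
        (hC p p.2 _ (jetDz_mem _)).1 (Fin.last k))
  have mz := derivation_minor hV (X := coordFn hf (jetX _ _))
    (P := coordFn hf (jetZ _ (Fin.last l).castSucc))
    (P' := coordFn hf (jetZ _ (Fin.last l).succ))
    (by
      ext p
      simpa [V₁, fieldDerivation_coordFn, coordFn_apply] using
        (hC p p.2 _ (jetDy_mem _)).2 (Fin.last l))
    (by
      ext p
      simpa [V₂, fieldDerivation_coordFn, coordFn_apply] using
        (hC p p.2 _ (jetDz_mem _)).2 (Fin.last l))
  have my := congrFun (congrArg Subtype.val my) ⟨q, hq⟩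
  have mz := congrFun (congrArg Subtype.val mz) ⟨q, hq⟩
  simp only [MulMemClass.coe_mul, Pi.mul_apply, V₁, V₂, fieldDerivation_coordFn, jetX_apply,
    jetY_apply, jetZ_apply, Fin.succ_last] at my mz
  set L := fderiv ℝ f q with hL
  set w := (L (jetDz _ _)).1 • jetDy (k + 1) (l + 1) - (L (jetDy _ _)).1 • jetDz _ _ with hw
  have hwC : w ∈ cartan q := Submodule.sub_mem _ (Submodule.smul_mem _ _ (jetDy_mem q))
    (Submodule.smul_mem _ _ (jetDz_mem q))
  have hLw : L w = 0 := by
    refine eq_zero_of_mem_cartan (hC q hq w hwC) ?_ ?_ ?_ <;> rw [hw] <;> simp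
    · ring
    · linear_combination my
    · linear_combination mz
  have hw0 := hinj q hq w hLw
  have h1 := congrArg (fun v => v.2.1 (Fin.last (k + 1))) hw0
  have h2 := congrArg (fun v => v.2.2 (Fin.last (l + 1))) hw0
  simp [hw, jetDy, jetDz, dzTop] at h1 h2
  exact ⟨h2, h1⟩

lemma IsLieTransformation.lowerJet_fderiv_jetDy
    {Φ : OpenPartialHomeomorph (MixedJet (k + 1) (l + 1)) (MixedJet (k + 1) (l + 1))}
    (hΦ : IsLieTransformation Φ) {q : MixedJet (k + 1) (l + 1)} (hq : q ∈ Φ.source) :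
    lowerJet _ _ (fderiv ℝ Φ q (jetDy _ _)) = 0 :=
  lowerJet_eq_zero_of_mem_cartan (hΦ.mapsTo hq (jetDy_mem q))
    (fderiv_jetDy_of_contact Φ.open_source hΦ.1 (fun _ h _ => hΦ.mapsTo h)
      (fun _ h _ => hΦ.injective h) hq).1

/-- The target Cartan space contains a vector with dx = 1. Since ∂/∂y_m and ∂/∂z_n contribute
nothing to dx, it must come from the total derivative. -/
lemma IsLieTransformation.fderiv_jetTotal_fst_ne_zero
    {Φ : OpenPartialHomeomorph (MixedJet (k + 1) (l + 1)) (MixedJet (k + 1) (l + 1))}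
    (hΦ : IsLieTransformation Φ) {q : MixedJet (k + 1) (l + 1)} (hq : q ∈ Φ.source) :
    (fderiv ℝ Φ q (jetTotal q)).1 ≠ 0 := by
  obtain ⟨h1, h2⟩ := fderiv_jetDy_of_contact Φ.open_source hΦ.1 (fun _ h _ => hΦ.mapsTo h)
      (fun _ h _ => hΦ.injective h) hq
  obtain ⟨v, hv, hv'⟩ := hΦ.surj hq (jetTotal_mem (Φ q))
  intro h0
  have hdec : v = v.1 • jetTotal q + (v.2.1 (Fin.last _)) • jetDy _ _ +
      v.2.2 (Fin.last _) • jetDz _ _ := by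
    rw [← sub_eq_zero]
    refine eq_zero_of_mem_cartan (q := q) ?_ ?_ ?_ ?_
    · exact Submodule.sub_mem _ hv (Submodule.add_mem _ (Submodule.add_mem _
        (Submodule.smul_mem _ _ (jetTotal_mem q)) (Submodule.smul_mem _ _ (jetDy_mem q)))
        (Submodule.smul_mem _ _ (jetDz_mem q)))
    all_goals simp [jetTotal, jetDy, jetDz, dzTop]
  have := congrArg Prod.fst hv'
  rw [hdec] at this
  simp [h0, h1, h2] at this

/-- The lower order components of an infinitesimal Lie transformation do not depend on `y_m`. -/
lemma IsInfinitesimalSymmetry.lowerJet_fderiv_jetDy {O : Set (MixedJet (k + 1) (l + 1))}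
    (hO : IsOpen O) {V : MixedJet (k + 1) (l + 1) → MixedJet (k + 1) (l + 1)}
    (hV : IsInfinitesimalSymmetry cartan O V) {q : MixedJet (k + 1) (l + 1)} (hq : q ∈ O) :
    lowerJet _ _ (fderiv ℝ V q (jetDy _ _)) = 0 := by
  obtain ⟨hVs, hC⟩ := (isInfinitesimalSymmetry_cartan_iff hO).1 hV
  have hid : ContDiffOn ℝ ∞ (fun q : MixedJet (k + 1) (l + 1) => q) O := contDiffOn_id
  have hx : (fderiv ℝ V q (jetDy _ _)).1 = 0 := by
    set V₁ := fieldDerivation hO (fun _ => jetDy (k + 1) (l + 1)) contDiffOn_const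
    set V₂ := fieldDerivation hO (fun _ => jetDz (k + 1) (l + 1)) contDiffOn_const
    have hV : ∀ g, V₁ (V₂ g) = V₂ (V₁ g) := fieldDerivation_const_comm_const hO _ _
    -- Infinitesimally one minor is enough: at the identity ∂z_n/∂y_m = 0 and ∂z_n/∂z_n = 1, so its
    -- ε-part isolates ∂ξ/∂y_m.
    have mz := minors_of_contact hV (x := dualFn hid hVs (jetX _ _))
      (P := dualFn hid hVs (jetZ _ (Fin.last l).castSucc))
      (P' := dualFn hid hVs (jetZ _ (Fin.last l).succ))
      (by
        ext p
        · simp [V₁, fieldDerivation_coordFn, jetDy]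
        · simpa [V₁, fieldDerivation_coordFn, coordFn_apply, jetDy] using
            (hC p p.2 _ (jetDy_mem _)).2 (Fin.last l))
      (by
        ext p
        · simp [V₂, fieldDerivation_coordFn, jetDz, dzTop, (Fin.castSucc_lt_last _).ne]
        · simpa [V₂, fieldDerivation_coordFn, coordFn_apply, jetDz, dzTop] using
            (hC p p.2 _ (jetDz_mem _)).2 (Fin.last l))
    have mz := congrFun (congrArg Subtype.val (congrArg TrivSqZeroExt.snd mz)) ⟨q, hq⟩
    simp [V₁, V₂, fieldDerivation_coordFn, jetDy, jetDz, dzTop] at mz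
    exact mz.symm
  refine lowerJet_eq_zero_of_mem_cartan (q := q) ⟨fun i => ?_, fun j => ?_⟩ hx
  · rw [(hC q hq _ (jetDy_mem q)).1 i]; simp [jetDy]
  · rw [(hC q hq _ (jetDy_mem q)).2 j]; simp [jetDy]

end LieTransformation

/-! ### Prolongation to the jet space -/

namespace MongeEquation

section Lift

variable {m n : ℕ}

/-- A map or vector field on internal coordinates, extended to jets by prescribing the
components `s` and `t` along `∂/∂z_n` and `∂/∂y_m`. -/
noncomputable def liftTop (f : MongeCoord m n → MongeCoord m n) (s t : MixedJet m n → ℝ)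
    (q : MixedJet m n) : MixedJet m n :=
  joinTop m n (f (forgetTop m n q) +
    (s q - coordZ m n (Fin.last n) (f (forgetTop m n q))) • dzTop m n, t q)

variable {f : MongeCoord m n → MongeCoord m n} {s t : MixedJet m n → ℝ}

lemma forgetTop_liftTop (q : MixedJet m n) : forgetTop m n (liftTop f s t q) =
    f (forgetTop m n q) +
      (s q - coordZ m n (Fin.last n) (f (forgetTop m n q))) • dzTop m n := by
  rw [liftTop, forgetTop_joinTop]

lemma lowerJet_liftTop (q : MixedJet m n) :
    lowerJet m n (liftTop f s t q) = lowerCoord m n (f (forgetTop m n q)) := by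
  rw [lowerJet_apply, forgetTop_liftTop]
  simp

@[simp] lemma liftTop_fst (q : MixedJet m n) :
    (liftTop f s t q).1 = (f (forgetTop m n q)).1 := by
  simp [liftTop, dzTop]

@[simp] lemma liftTop_y_castSucc (q : MixedJet m n) (i : Fin m) :
    (liftTop f s t q).2.1 i.castSucc = (f (forgetTop m n q)).2.1 i := by
  simp [liftTop, dzTop]

@[simp] lemma liftTop_y_last (q : MixedJet m n) :
    (liftTop f s t q).2.1 (Fin.last m) = t q := by
  simp [liftTop]

@[simp] lemma liftTop_z_castSucc (q : MixedJet m n) (j : Fin n) :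
    (liftTop f s t q).2.2 j.castSucc = (f (forgetTop m n q)).2.2 j.castSucc := by
  simp [liftTop, dzTop, (Fin.castSucc_lt_last _).ne]

@[simp] lemma liftTop_z_last (q : MixedJet m n) :
    (liftTop f s t q).2.2 (Fin.last n) = s q := by
  simp [liftTop, dzTop, coordZ]

lemma contDiffOn_liftTop {U : Set (MongeCoord m n)} (hf : ContDiffOn ℝ ∞ f U)
    (hs : ContDiffOn ℝ ∞ s (forgetTop m n ⁻¹' U)) (ht : ContDiffOn ℝ ∞ t (forgetTop m n ⁻¹' U)) :
    ContDiffOn ℝ ∞ (liftTop f s t) (forgetTop m n ⁻¹' U) := by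
  have h1 : ContDiffOn ℝ ∞ (fun q => f (forgetTop m n q)) (forgetTop m n ⁻¹' U) :=
    hf.comp (forgetTop m n).contDiff.contDiffOn fun q hq => hq
  exact (joinTop m n).contDiff.comp_contDiffOn ((h1.add ((hs.sub
    ((coordZ m n (Fin.last n)).contDiff.comp_contDiffOn h1)).smul contDiffOn_const)).prodMk ht)

lemma lowerJet_fderiv_liftTop {U : Set (MongeCoord m n)} (hU : IsOpen U)
    (hf : ContDiffOn ℝ ∞ f U) (hs : ContDiffOn ℝ ∞ s (forgetTop m n ⁻¹' U))
    (ht : ContDiffOn ℝ ∞ t (forgetTop m n ⁻¹' U)) {q : MixedJet m n}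
    (hq : forgetTop m n q ∈ U) (v : MixedJet m n) :
    lowerJet m n (fderiv ℝ (liftTop f s t) q v) =
      lowerCoord m n (fderiv ℝ f (forgetTop m n q) (forgetTop m n v)) := by
  have hO : IsOpen (forgetTop m n ⁻¹' U) := hU.preimage (forgetTop m n).continuous
  have h1 := fderiv_continuousLinear_comp (lowerJet m n)
    (smooth_differentiableAt hO (contDiffOn_liftTop hf hs ht) hq) v
  rw [← h1]
  simp only [lowerJet_liftTop]
  have hd := (smooth_differentiableAt hU hf hq).hasFDerivAt.comp q (forgetTop m n).hasFDerivAt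
  have hd : HasFDerivAt (fun q => f (forgetTop m n q)) _ q := hd
  rw [fderiv_continuousLinear_comp _ hd.differentiableAt, hd.fderiv]
  rfl

/-- The lower order components of the derivative of a lift on the Cartan distribution. -/
lemma fderiv_liftTop_of_mem_cartan {U : Set (MongeCoord m n)} (hU : IsOpen U)
    (hf : ContDiffOn ℝ ∞ f U) (hs : ContDiffOn ℝ ∞ s (forgetTop m n ⁻¹' U))
    (ht : ContDiffOn ℝ ∞ t (forgetTop m n ⁻¹' U)) {q : MixedJet m n}
    (hq : forgetTop m n q ∈ U)
    (hZ : lowerCoord m n (fderiv ℝ f (forgetTop m n q) (dzTop m n)) = 0) {v : MixedJet m n}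
    (hv : v ∈ cartan q) :
    (fderiv ℝ (liftTop f s t) q v).1 = v.1 * (fderiv ℝ f (forgetTop m n q) (total q)).1 ∧
    (∀ i : Fin m, (fderiv ℝ (liftTop f s t) q v).2.1 i.castSucc =
      v.1 * (fderiv ℝ f (forgetTop m n q) (total q)).2.1 i) ∧
    ∀ j : Fin n, (fderiv ℝ (liftTop f s t) q v).2.2 j.castSucc =
      v.1 * (fderiv ℝ f (forgetTop m n q) (total q)).2.2 j.castSucc := by
  have h := lowerJet_fderiv_liftTop hU hf hs ht hq v
  rw [forgetTop_of_mem_cartan hv, map_add, map_smul, map_smul, map_add, map_smul, map_smul, hZ,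
    smul_zero, add_zero, ← map_smul, lowerJet_apply, lowerCoord_eq_iff] at h
  exact h

lemma contDiffOn_fderiv_total {U : Set (MongeCoord m n)} (hU : IsOpen U)
    (hf : ContDiffOn ℝ ∞ f U) :
    ContDiffOn ℝ ∞ (fun q => fderiv ℝ f (forgetTop m n q) (total q)) (forgetTop m n ⁻¹' U) :=
  ((hf.fderiv_of_isOpen (m := ∞) hU (by simp)).comp (forgetTop m n).contDiff.contDiffOn
    fun _ hq => hq).clm_apply contDiff_total.contDiffOn

end Lift

lemma cylinder_eq {m n : ℕ} (E : MongeEquation m n) :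
    E.cylinder = forgetTop m n ⁻¹' E.dom := rfl

lemma isOpen_cylinder {m n : ℕ} (E : MongeEquation m n) : IsOpen E.cylinder :=
  E.isOpen_dom.preimage (forgetTop m n).continuous

lemma embed_mem_cylinder {m n : ℕ} (E : MongeEquation m n) {p : MongeCoord m n}
    (hp : p ∈ E.dom) : E.embed p ∈ E.cylinder := by
  rw [cylinder_eq, Set.mem_preimage, forgetTop_embed]; exact hp

section Prolongation

variable {k l : ℕ} {E E' : MongeEquation (k + 1) (l + 2)}

lemma _root_.PreservesFibers.lowerCoord_top
    {L : MongeCoord (k + 1) (l + 2) →L[ℝ] MongeCoord (k + 1) (l + 2)} (hL : PreservesFibers L) :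
    lowerCoord _ _ (L (dzTop _ _)) = 0 := by
  rw [← map_zero (lowerCoord _ _), lowerCoord_eq_iff]
  exact ⟨hL.top_x, hL.top_y, hL.top_z⟩

/-- The two total derivatives differ by (y_m - F) ∂/∂y_{m-1}, whose image has none of these
components. -/
lemma _root_.PreservesFibers.apply_total
    {L : MongeCoord (k + 1) (l + 2) →L[ℝ] MongeCoord (k + 1) (l + 2)} (hL : PreservesFibers L)
    (E : MongeEquation (k + 1) (l + 2)) (q : MixedJet (k + 1) (l + 2)) :
    (L (total q)).1 = (L (total (E.embed (forgetTop _ _ q)))).1 ∧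
    (∀ i : Fin k, (L (total q)).2.1 i.castSucc =
      (L (total (E.embed (forgetTop _ _ q)))).2.1 i.castSucc) ∧
    ∀ j : Fin (l + 1), (L (total q)).2.2 j.castSucc.castSucc =
      (L (total (E.embed (forgetTop _ _ q)))).2.2 j.castSucc.castSucc := by
  have h : total q = total (E.embed (forgetTop _ _ q)) +
      (q.2.1 (Fin.last _) - E.F (forgetTop _ _ q)) • dySub k (l + 2) := by
    conv_lhs => rw [← joinTop_forgetTop q]
    rw [total_joinTop k _ _ (E.F (forgetTop _ _ q)), embed_eq]
  rw [h, map_add, map_smul]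
  simp [hL.sub_x, hL.sub_y, hL.sub_z]

/-- The prolongation of an internal equivalence to jets. -/
noncomputable def prolong (f : MongeCoord (k + 1) (l + 2) → MongeCoord (k + 1) (l + 2)) :
    MixedJet (k + 1) (l + 2) → MixedJet (k + 1) (l + 2) :=
  liftTop f
    (fun q => (fderiv ℝ f (forgetTop _ _ q) (total q)).2.2 (Fin.last (l + 1)).castSucc /
      (fderiv ℝ f (forgetTop _ _ q) (total q)).1)
    (fun q => (fderiv ℝ f (forgetTop _ _ q) (total q)).2.1 (Fin.last k) /
      (fderiv ℝ f (forgetTop _ _ q) (total q)).1)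

/-- The prolongation of an internal symmetry to jets. -/
noncomputable def prolongField (X : MongeCoord (k + 1) (l + 2) → MongeCoord (k + 1) (l + 2)) :
    MixedJet (k + 1) (l + 2) → MixedJet (k + 1) (l + 2) :=
  liftTop X
    (fun q => (fderiv ℝ X (forgetTop _ _ q) (total q)).2.2 (Fin.last (l + 1)).castSucc -
      q.2.2 (Fin.last _) * (fderiv ℝ X (forgetTop _ _ q) (total q)).1)
    (fun q => (fderiv ℝ X (forgetTop _ _ q) (total q)).2.1 (Fin.last k) -
      q.2.1 (Fin.last _) * (fderiv ℝ X (forgetTop _ _ q) (total q)).1)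

section Field

variable {X : MongeCoord (k + 1) (l + 2) → MongeCoord (k + 1) (l + 2)}

lemma contDiffOn_prolongField_coeffs (hX : ContDiffOn ℝ ∞ X E.dom) :
    ContDiffOn ℝ ∞ (fun q : MixedJet (k + 1) (l + 2) =>
      (fderiv ℝ X (forgetTop _ _ q) (total q)).2.2 (Fin.last (l + 1)).castSucc -
      q.2.2 (Fin.last _) * (fderiv ℝ X (forgetTop _ _ q) (total q)).1) (forgetTop _ _ ⁻¹' E.dom) ∧
    ContDiffOn ℝ ∞ (fun q : MixedJet (k + 1) (l + 2) =>
      (fderiv ℝ X (forgetTop _ _ q) (total q)).2.1 (Fin.last k) -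
      q.2.1 (Fin.last _) * (fderiv ℝ X (forgetTop _ _ q) (total q)).1)
        (forgetTop _ _ ⁻¹' E.dom) := by
  have h := contDiffOn_fderiv_total E.isOpen_dom hX
  exact ⟨((coordZ _ _ _).contDiff.comp_contDiffOn h).sub
      ((jetZ _ _).contDiff.contDiffOn.mul ((coordX _ _).contDiff.comp_contDiffOn h)),
    ((coordY _ _ _).contDiff.comp_contDiffOn h).sub
      ((jetY _ _).contDiff.contDiffOn.mul ((coordX _ _).contDiff.comp_contDiffOn h))⟩

/-- The top contact equations hold by the choice of the top coefficients. The others do not see y_m,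
so they reduce to the equation. -/
lemma prolongField_isInfinitesimalSymmetry (hX : E.IsInternalSymmetry X)
    (hP : ∀ p ∈ E.dom, PreservesFibers (fderiv ℝ X p)) :
    IsInfinitesimalSymmetry cartan E.cylinder (prolongField X) := by
  obtain ⟨hs, ht⟩ := contDiffOn_prolongField_coeffs hX.1
  rw [isInfinitesimalSymmetry_cartan_iff E.isOpen_cylinder]
  refine ⟨contDiffOn_liftTop hX.1 hs ht, fun q hq v hv => ?_⟩
  have hq' : forgetTop _ _ q ∈ E.dom := hq
  have hPq := hP _ hq'
  obtain ⟨e1, e2, e3⟩ := fderiv_liftTop_of_mem_cartan E.isOpen_dom hX.1 hs ht hq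
    hPq.lowerCoord_top hv
  obtain ⟨a1, a2, a3⟩ := hPq.apply_total E q
  obtain ⟨c1, c2⟩ := (isInternalSymmetry_iff.1 hX).2 _ hq' _ (E.total_embed_mem hq')
  rw [prolongField]
  refine ⟨fun i => ?_, fun j => ?_⟩
  · rw [e1, e2]
    refine Fin.lastCases ?_ (fun i => ?_) i
    · rw [Fin.succ_last, liftTop_y_last]; ring
    · rw [Fin.succ_castSucc, liftTop_y_castSucc, a2, a1, c1, Fin.succ_castSucc, embed_y_castSucc,
        fderiv_embed E hq', joinTop_y, Fin.snoc_castSucc, total_fst]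
      simp only [forgetTop_apply, Fin.init]
      ring
  · rw [e1, e3]
    refine Fin.lastCases ?_ (fun j => ?_) j
    · rw [Fin.succ_last, liftTop_z_last]; ring
    · rw [Fin.succ_castSucc, liftTop_z_castSucc, a3, a1, c2, Fin.succ_castSucc, total_fst]
      simp only [forgetTop_apply]
      ring

lemma prolongField_embed (hX : E.IsInternalSymmetry X) {p : MongeCoord (k + 1) (l + 2)}
    (hp : p ∈ E.dom) : prolongField X (E.embed p) = fderiv ℝ E.embed p (X p) := by
  obtain ⟨c1, c2⟩ := (isInternalSymmetry_iff.1 hX).2 _ hp _ (E.total_embed_mem hp)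
  have c1 := c1 (Fin.last k)
  have c2 := c2 (Fin.last (l + 1))
  rw [Fin.succ_last] at c1 c2
  rw [total_fst, mul_one] at c1 c2
  rw [prolongField]
  refine Prod.ext ?_ (Prod.ext ?_ ?_)
  · rw [liftTop_fst, forgetTop_embed, fderiv_embed E hp]; rfl
  · ext i
    refine Fin.lastCases ?_ (fun i => ?_) i
    · rw [liftTop_y_last, forgetTop_embed, c1]; ring
    · rw [liftTop_y_castSucc, forgetTop_embed, fderiv_embed E hp]; simp
  · ext j
    refine Fin.lastCases ?_ (fun j => ?_) j
    · rw [liftTop_z_last, forgetTop_embed, c2, fderiv_embed E hp, embed_z]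
      simp
    · rw [liftTop_z_castSucc, forgetTop_embed, fderiv_embed E hp]; simp

end Field

section Map

variable {Ψ : OpenPartialHomeomorph (MongeCoord (k + 1) (l + 2)) (MongeCoord (k + 1) (l + 2))}

/-- Otherwise D and Z, taken at the point of the equation below q, would both be mapped into the
line of ∂/∂z_n, contrary to injectivity. -/
lemma IsInternalEquiv.fderiv_total_fst_ne_zero (hΨ : E.IsInternalEquiv E' Ψ)
    (hP : ∀ p ∈ E.dom, PreservesFibers (fderiv ℝ Ψ p)) {q : MixedJet (k + 1) (l + 2)}
    (hq : q ∈ E.cylinder) : (fderiv ℝ Ψ (forgetTop _ _ q) (total q)).1 ≠ 0 := by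
  have hs : forgetTop _ _ q ∈ Ψ.source := by rw [hΨ.1]; exact hq
  have hq' : forgetTop _ _ q ∈ E.dom := hq
  have hPq := hP _ hq'
  rw [(hPq.apply_total E q).1]
  intro h0
  set L := fderiv ℝ Ψ (forgetTop _ _ q) with hL
  have h1 := eq_smul_of_mem_distribution (hΨ.map_mem hq')
    (hΨ.2.2.mapsTo hs (E.total_embed_mem hq')) h0
  have h2 := eq_smul_of_mem_distribution (hΨ.map_mem hq')
    (hΨ.2.2.mapsTo hs (E.dzTop_mem hq')) hPq.top_x
  rw [← hL] at h1 h2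
  set r := (L (total (E.embed (forgetTop _ _ q)))).2.2 (Fin.last _)
  set c := (L (dzTop _ _)).2.2 (Fin.last _)
  have h3 : L (c • total (E.embed (forgetTop _ _ q)) - r • dzTop _ _) = 0 := by
    rw [map_sub, map_smul, map_smul, h1, h2, smul_smul, smul_smul, mul_comm, sub_self]
  have h4 := congrArg Prod.fst (hΨ.2.2.injective hs h3)
  simp [dzTop] at h4
  rw [h4, zero_smul] at h2
  have h5 := congrArg (fun w : MongeCoord (k + 1) (l + 2) => w.2.2 (Fin.last _))
    (hΨ.2.2.injective hs h2)
  simp [dzTop] at h5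

lemma contDiffOn_prolong_coeffs (hΨ : E.IsInternalEquiv E' Ψ)
    (hP : ∀ p ∈ E.dom, PreservesFibers (fderiv ℝ Ψ p)) :
    ContDiffOn ℝ ∞ (fun q : MixedJet (k + 1) (l + 2) =>
      (fderiv ℝ Ψ (forgetTop _ _ q) (total q)).2.2 (Fin.last (l + 1)).castSucc /
      (fderiv ℝ Ψ (forgetTop _ _ q) (total q)).1) (forgetTop _ _ ⁻¹' E.dom) ∧
    ContDiffOn ℝ ∞ (fun q : MixedJet (k + 1) (l + 2) =>
      (fderiv ℝ Ψ (forgetTop _ _ q) (total q)).2.1 (Fin.last k) /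
      (fderiv ℝ Ψ (forgetTop _ _ q) (total q)).1) (forgetTop _ _ ⁻¹' E.dom) := by
  have h := contDiffOn_fderiv_total E.isOpen_dom hΨ.smooth
  have hne := fun q hq => hΨ.fderiv_total_fst_ne_zero hP (q := q) hq
  exact ⟨((coordZ _ _ _).contDiff.comp_contDiffOn h).div
      ((coordX _ _).contDiff.comp_contDiffOn h) hne,
    ((coordY _ _ _).contDiff.comp_contDiffOn h).div
      ((coordX _ _).contDiff.comp_contDiffOn h) hne⟩

lemma contDiffOn_prolong (hΨ : E.IsInternalEquiv E' Ψ)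
    (hP : ∀ p ∈ E.dom, PreservesFibers (fderiv ℝ Ψ p)) :
    ContDiffOn ℝ ∞ (prolong Ψ) E.cylinder :=
  contDiffOn_liftTop hΨ.smooth (contDiffOn_prolong_coeffs hΨ hP).1
    (contDiffOn_prolong_coeffs hΨ hP).2

lemma prolong_mem_cartan (hΨ : E.IsInternalEquiv E' Ψ)
    (hP : ∀ p ∈ E.dom, PreservesFibers (fderiv ℝ Ψ p)) {q : MixedJet (k + 1) (l + 2)}
    (hq : q ∈ E.cylinder) {v : MixedJet (k + 1) (l + 2)} (hv : v ∈ cartan q) :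
    fderiv ℝ (prolong Ψ) q v ∈ cartan (prolong Ψ q) := by
  obtain ⟨hs, ht⟩ := contDiffOn_prolong_coeffs hΨ hP
  have hne := hΨ.fderiv_total_fst_ne_zero hP hq
  have hps : forgetTop _ _ q ∈ Ψ.source := by rw [hΨ.1]; exact hq
  have hq' : forgetTop _ _ q ∈ E.dom := hq
  have hPq := hP _ hq'
  obtain ⟨e1, e2, e3⟩ := fderiv_liftTop_of_mem_cartan E.isOpen_dom hΨ.smooth hs ht hq
    hPq.lowerCoord_top hv
  obtain ⟨a1, a2, a3⟩ := hPq.apply_total E q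
  obtain ⟨c1, c2⟩ := (mem_distribution E' (hΨ.map_mem hq')).1
    (hΨ.2.2.mapsTo hps (E.total_embed_mem hq'))
  rw [mem_cartan, prolong]
  refine ⟨fun i => ?_, fun j => ?_⟩
  · rw [e1, e2]
    refine Fin.lastCases ?_ (fun i => ?_) i
    · rw [Fin.succ_last, liftTop_y_last]; field_simp
    · rw [Fin.succ_castSucc, liftTop_y_castSucc, a2, a1, c1, Fin.succ_castSucc, embed_y_castSucc]
      ring
  · rw [e1, e3]
    refine Fin.lastCases ?_ (fun j => ?_) j
    · rw [Fin.succ_last, liftTop_z_last]; field_simp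
    · rw [Fin.succ_castSucc, liftTop_z_castSucc, a3, a1, c2, Fin.succ_castSucc]
      ring

lemma prolong_embed (hΨ : E.IsInternalEquiv E' Ψ)
    (hP : ∀ p ∈ E.dom, PreservesFibers (fderiv ℝ Ψ p)) {p : MongeCoord (k + 1) (l + 2)}
    (hp : p ∈ E.dom) : prolong Ψ (E.embed p) = E'.embed (Ψ p) := by
  have hne := hΨ.fderiv_total_fst_ne_zero hP (E.embed_mem_cylinder hp)
  have hps : p ∈ Ψ.source := by rw [hΨ.1]; exact hp
  obtain ⟨c1, c2⟩ := (mem_distribution E' (hΨ.map_mem hp)).1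
    (hΨ.2.2.mapsTo hps (E.total_embed_mem hp))
  have c1 := c1 (Fin.last k)
  have c2 := c2 (Fin.last (l + 1))
  rw [Fin.succ_last] at c1 c2
  rw [forgetTop_embed] at hne
  rw [prolong]
  refine Prod.ext ?_ (Prod.ext ?_ ?_)
  · rw [liftTop_fst, forgetTop_embed]; rfl
  · ext i
    refine Fin.lastCases ?_ (fun i => ?_) i
    · rw [liftTop_y_last, forgetTop_embed, c1, mul_div_cancel_right₀ _ hne]
    · rw [liftTop_y_castSucc, forgetTop_embed, embed_y_castSucc]
  · ext j
    refine Fin.lastCases ?_ (fun j => ?_) j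
    · rw [liftTop_z_last, forgetTop_embed, c2, mul_div_cancel_right₀ _ hne]; rfl
    · rw [liftTop_z_castSucc, forgetTop_embed, embed_z]

end Map

end Prolongation

end MongeEquation

/-! ### Partial homeomorphisms from mutually inverse maps -/

section LocalInverse

/-- Two continuous maps between open sets that are mutually inverse near some points define an
open partial homeomorphism. -/
noncomputable def OpenPartialHomeomorph.ofLocalInverse {X Y : Type*} [TopologicalSpace X]
    [TopologicalSpace Y] (f : X → Y) (g : Y → X) (S : Set X) (T : Set Y) (hS : IsOpen S)
    (hT : IsOpen T) (hf : ContinuousOn f S) (hg : ContinuousOn g T)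
    (hgf : ∀ x ∈ S, g (f x) = x) (hfg : ∀ y ∈ T, f (g y) = y) : OpenPartialHomeomorph X Y where
  toFun := f
  invFun := g
  source := S ∩ f ⁻¹' T
  target := T ∩ g ⁻¹' S
  map_source' := fun x hx => ⟨hx.2, by
    rw [Set.mem_preimage, hgf x hx.1]; exact hx.1⟩
  map_target' := fun y hy => ⟨hy.2, by
    rw [Set.mem_preimage, hfg y hy.1]; exact hy.1⟩
  left_inv' := fun x hx => hgf x hx.1
  right_inv' := fun y hy => hfg y hy.1
  open_source := hf.isOpen_inter_preimage hS hT
  open_target := hg.isOpen_inter_preimage hT hS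
  continuousOn_toFun := hf.mono Set.inter_subset_left
  continuousOn_invFun := hg.mono Set.inter_subset_left

lemma IsDistributionEquiv.of_mapsTo {X Y : Type*} [NormedAddCommGroup X] [NormedSpace ℝ X]
    [NormedAddCommGroup Y] [NormedSpace ℝ Y] {D : X → Submodule ℝ X} {D' : Y → Submodule ℝ Y}
    {Φ : OpenPartialHomeomorph X Y} (h1 : ContDiffOn ℝ ∞ Φ Φ.source)
    (h2 : ContDiffOn ℝ ∞ Φ.symm Φ.target)
    (h3 : ∀ p ∈ Φ.source, ∀ v ∈ D p, fderiv ℝ Φ p v ∈ D' (Φ p))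
    (h4 : ∀ q ∈ Φ.target, ∀ v ∈ D' q, fderiv ℝ Φ.symm q v ∈ D (Φ.symm q)) :
    IsDistributionEquiv D D' Φ := by
  refine ⟨h1, h2, fun p hp => le_antisymm ?_ fun v hv => ?_⟩
  · rintro _ ⟨v, hv, rfl⟩
    exact h3 p hp v hv
  -- The trivial distribution gives access to the inversion of differentials, which depends only on
  -- smoothness of both maps.
  · have h : IsDistributionEquiv (fun _ => ⊥) (fun _ => ⊥) Φ :=
      ⟨h1, h2, fun _ _ => Submodule.map_bot _⟩
    refine ⟨fderiv ℝ Φ.symm (Φ p) v, ?_, h.apply_fderiv_symm hp v⟩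
    have := h4 _ (Φ.map_source hp) v hv
    rwa [Φ.left_inv hp] at this

end LocalInverse

/-! ### Determination by the equation, and inversion -/

namespace MongeEquation

section Segments

variable {m n : ℕ} (E : MongeEquation m n)

lemma sub_embed_eq (q : MixedJet m n) :
    q - E.embed (forgetTop m n q) =
      (q.2.1 (Fin.last m) - E.F (forgetTop m n q)) • jetDy m n := by
  rw [sub_eq_iff_eq_add, add_comm, embed_eq, add_smul_jetDy, add_sub_cancel, joinTop_forgetTop]

/-- The points over the domain of the equation whose vertical segment to the equation lies in
the given set. -/
def fiberStar (O : Set (MixedJet m n)) : Set (MixedJet m n) :=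
  {q | forgetTop m n q ∈ E.dom ∧ ∀ t ∈ Set.Icc (0 : ℝ) 1,
    E.embed (forgetTop m n q) + t • (q - E.embed (forgetTop m n q)) ∈ O}

lemma continuousAt_embed {p : MongeCoord m n} (hp : p ∈ E.dom) : ContinuousAt E.embed p :=
  (E.hasFDerivAt_embed hp).continuousAt

lemma fiberStar_mem_nhds {O : Set (MixedJet m n)} (hO : IsOpen O) {p : MongeCoord m n}
    (hp : p ∈ E.dom) (hpO : E.embed p ∈ O) : E.fiberStar O ∈ 𝓝 (E.embed p) := by
  obtain ⟨ε, hε, hball⟩ := Metric.isOpen_iff.1 hO _ hpO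
  have h1 : Filter.Tendsto (fun q => E.embed (forgetTop m n q)) (𝓝 (E.embed p))
      (𝓝 (E.embed p)) := by
    have h2 : Filter.Tendsto (forgetTop m n) (𝓝 (E.embed p)) (𝓝 p) := by
      have := (forgetTop m n).continuous.tendsto (E.embed p)
      rwa [forgetTop_embed] at this
    exact Filter.Tendsto.comp (E.continuousAt_embed hp) h2
  filter_upwards [E.isOpen_cylinder.mem_nhds (E.embed_mem_cylinder hp),
    h1 (Metric.ball_mem_nhds _ hε), Metric.ball_mem_nhds _ hε] with q hq hq1 hq2
  exact ⟨hq, fun t ht => hball ((convex_ball _ _).add_smul_sub_mem hq1 hq2 ht)⟩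

lemma fiberStar_cylinder : E.fiberStar E.cylinder = E.cylinder := by
  ext q
  refine ⟨fun h => h.1, fun h => ⟨h, fun t _ => ?_⟩⟩
  rw [cylinder_eq, Set.mem_preimage, map_add, map_smul, map_sub, forgetTop_embed, sub_self,
    smul_zero, add_zero]
  exact h

lemma mem_of_mem_fiberStar {O : Set (MixedJet m n)} {q : MixedJet m n}
    (hq : q ∈ E.fiberStar O) : q ∈ O := by
  simpa using hq.2 1 (by simp)

end Segments

section Determination

variable {k l : ℕ} {E E' : MongeEquation (k + 1) (l + 2)}

lemma lowerJet_eq_of_fiberStar {O : Set (MixedJet (k + 1) (l + 2))} (hO : IsOpen O)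
    {f : MixedJet (k + 1) (l + 2) → MixedJet (k + 1) (l + 2)} (hf : ContDiffOn ℝ ∞ f O)
    (h : ∀ q ∈ O, lowerJet _ _ (fderiv ℝ f q (jetDy _ _)) = 0)
    {q : MixedJet (k + 1) (l + 2)} (hq : q ∈ E.fiberStar O) :
    lowerJet _ _ (f q) = lowerJet _ _ (f (E.embed (forgetTop _ _ q))) := by
  have := eq_of_fderiv_apply_eq_zero (f := fun q => lowerJet _ _ (f q))
    (q := E.embed (forgetTop _ _ q)) (v := q - E.embed (forgetTop _ _ q))
    (fun t ht => (lowerJet _ _).differentiableAt.comp _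
      (smooth_differentiableAt hO hf (hq.2 t ht)))
    (fun t ht => by
      rw [fderiv_continuousLinear_comp _ (smooth_differentiableAt hO hf (hq.2 t ht))]
      conv_lhs => arg 2; arg 2; rw [sub_embed_eq]
      rw [map_smul, map_smul, h _ (hq.2 t ht), smul_zero])
  simpa using this

/-- Along vertical segments to the equation the lower components of V are constant, hence those of
X. A full neighbourhood is required because the top components come from differentiating this
identity. -/
lemma field_eq_prolongField {X : MongeCoord (k + 1) (l + 2) → MongeCoord (k + 1) (l + 2)}
    (hX : E.IsInternalSymmetry X) (hP : ∀ p ∈ E.dom, PreservesFibers (fderiv ℝ X p))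
    {O : Set (MixedJet (k + 1) (l + 2))} (hO : IsOpen O)
    {V : MixedJet (k + 1) (l + 2) → MixedJet (k + 1) (l + 2)}
    (hV : IsInfinitesimalSymmetry cartan O V) (hVX : E.RestrictsTo O V X)
    {q : MixedJet (k + 1) (l + 2)} (hq : E.fiberStar O ∈ 𝓝 q) : V q = prolongField X q := by
  have hq0 := mem_of_mem_nhds hq
  refine eq_of_lowerJet_eventuallyEq_field hO E.isOpen_cylinder hV
    (prolongField_isInfinitesimalSymmetry hX hP) (E.mem_of_mem_fiberStar hq0) hq0.1 ?_
  filter_upwards [hq] with x hx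
  have hx0 : E.embed (forgetTop _ _ x) ∈ O := by simpa using hx.2 0 (by simp)
  rw [lowerJet_eq_of_fiberStar hO hV.1 (fun q hq => hV.lowerJet_fderiv_jetDy hO hq) hx,
    hVX _ hx.1 hx0, lowerJet_apply, forgetTop_fderiv_embed E hx.1, prolongField,
    lowerJet_liftTop]

variable {Ψ : OpenPartialHomeomorph (MongeCoord (k + 1) (l + 2)) (MongeCoord (k + 1) (l + 2))}

lemma eq_prolong (hΨ : E.IsInternalEquiv E' Ψ)
    (hP : ∀ p ∈ E.dom, PreservesFibers (fderiv ℝ Ψ p))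
    {Φ : OpenPartialHomeomorph (MixedJet (k + 1) (l + 2)) (MixedJet (k + 1) (l + 2))}
    (hΦ : IsLieTransformation Φ) (hΦΨ : E.Induces E' Φ Ψ)
    {q : MixedJet (k + 1) (l + 2)} (hq : E.fiberStar Φ.source ∈ 𝓝 q) : Φ q = prolong Ψ q := by
  have hq0 := mem_of_mem_nhds hq
  have hqs := E.mem_of_mem_fiberStar hq0
  refine eq_of_lowerJet_eventuallyEq (hΦ.differentiableAt hqs)
    (smooth_differentiableAt E.isOpen_cylinder (contDiffOn_prolong hΨ hP) hq0.1) ?_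
    (hΦ.mapsTo hqs (jetTotal_mem q)) (prolong_mem_cartan hΨ hP hq0.1 (jetTotal_mem q))
    (hΦ.fderiv_jetTotal_fst_ne_zero hqs)
  filter_upwards [hq] with x hx
  have hx0 : E.embed (forgetTop _ _ x) ∈ Φ.source := by simpa using hx.2 0 (by simp)
  rw [lowerJet_eq_of_fiberStar Φ.open_source hΦ.1
    (fun q hq => hΦ.lowerJet_fderiv_jetDy hq) hx, hΦΨ _ hx.1 hx0, lowerJet_apply,
    forgetTop_embed, prolong, lowerJet_liftTop]

/-- The points whose image under the prolongation can be joined to the equation along the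
`z_n`-direction. -/
def invertible (E E' : MongeEquation (k + 1) (l + 2))
    (f : MongeCoord (k + 1) (l + 2) → MongeCoord (k + 1) (l + 2)) :
    Set (MixedJet (k + 1) (l + 2)) :=
  {q | forgetTop _ _ q ∈ E.dom ∧ ∀ t ∈ Set.Icc (0 : ℝ) 1,
    f (forgetTop _ _ q) + t • (forgetTop _ _ (prolong f q) - f (forgetTop _ _ q)) ∈ E'.dom}

/-- At a point of the equation the segment shrinks to Ψ p, so nearby it stays in a ball contained in
the open domain. -/
lemma invertible_mem_nhds (hΨ : E.IsInternalEquiv E' Ψ)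
    (hP : ∀ p ∈ E.dom, PreservesFibers (fderiv ℝ Ψ p)) {p : MongeCoord (k + 1) (l + 2)}
    (hp : p ∈ E.dom) : invertible E E' Ψ ∈ 𝓝 (E.embed p) := by
  obtain ⟨ε, hε, hball⟩ := Metric.isOpen_iff.1 E'.isOpen_dom _ (hΨ.map_mem hp)
  have h1 : Filter.Tendsto (fun q => Ψ (forgetTop _ _ q)) (𝓝 (E.embed p)) (𝓝 (Ψ p)) := by
    have h2 : Filter.Tendsto (forgetTop _ _) (𝓝 (E.embed p)) (𝓝 p) := by
      have := (forgetTop _ _).continuous.tendsto (E.embed p)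
      rwa [forgetTop_embed] at this
    exact Filter.Tendsto.comp
      (smooth_differentiableAt E.isOpen_dom hΨ.smooth hp).continuousAt h2
  have h2 : Filter.Tendsto (fun q => forgetTop _ _ (prolong Ψ q)) (𝓝 (E.embed p))
      (𝓝 (Ψ p)) := by
    have := (forgetTop _ _).continuous.continuousAt.comp
      (smooth_differentiableAt E.isOpen_cylinder (contDiffOn_prolong hΨ hP)
        (E.embed_mem_cylinder hp)).continuousAt
    have := this.tendsto
    rwa [Function.comp_apply, prolong_embed hΨ hP hp, forgetTop_embed] at this
  filter_upwards [E.isOpen_cylinder.mem_nhds (E.embed_mem_cylinder hp),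
    h1 (Metric.ball_mem_nhds _ hε), h2 (Metric.ball_mem_nhds _ hε)] with q hq hq1 hq2
  exact ⟨hq, fun t ht => hball ((convex_ball _ _).add_smul_sub_mem hq1 hq2 ht)⟩

/-- The prolongations of an internal equivalence and of its inverse are inverse to each other. -/
lemma prolong_symm_prolong (hΨ : E.IsInternalEquiv E' Ψ)
    (hP : ∀ p ∈ E.dom, PreservesFibers (fderiv ℝ Ψ p))
    (hP' : ∀ p ∈ E'.dom, PreservesFibers (fderiv ℝ Ψ.symm p))
    {q : MixedJet (k + 1) (l + 2)} (hq : invertible E E' Ψ ∈ 𝓝 q) :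
    prolong Ψ.symm (prolong Ψ q) = q := by
  have hq0 := mem_of_mem_nhds hq
  have hcyl : ∀ x ∈ invertible E E' Ψ, prolong Ψ x ∈ E'.cylinder := fun x hx => by
    have := hx.2 1 (by simp)
    rwa [one_smul, add_sub_cancel] at this
  have d1 := (smooth_differentiableAt E.isOpen_cylinder (contDiffOn_prolong hΨ hP)
    hq0.1).hasFDerivAt
  have d2 := (smooth_differentiableAt E'.isOpen_cylinder (contDiffOn_prolong hΨ.symm hP')
    (hcyl q hq0)).hasFDerivAt
  have d3 : HasFDerivAt (fun x => prolong Ψ.symm (prolong Ψ x)) _ q := d2.comp q d1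
  symm
  refine eq_of_lowerJet_eventuallyEq (f := fun x => x)
    (g := fun x => prolong Ψ.symm (prolong Ψ x)) differentiableAt_id d3.differentiableAt ?_
    ?_ ?_ ?_
  -- The internal coordinates of `prolong Ψ x` differ from Ψ of those of x only in z_n. Along this
  -- segment the lower components of `Ψ.symm` are constant.
  · filter_upwards [hq] with x hx
    have hs : forgetTop _ _ x ∈ Ψ.source := by rw [hΨ.1]; exact hx.1
    rw [prolong, lowerJet_liftTop]
    have hd : ∀ t ∈ Set.Icc (0 : ℝ) 1, DifferentiableAt ℝ Ψ.symm (Ψ (forgetTop _ _ x) +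
        t • (forgetTop _ _ (prolong Ψ x) - Ψ (forgetTop _ _ x))) := fun t ht =>
      smooth_differentiableAt E'.isOpen_dom hΨ.symm.smooth (hx.2 t ht)
    have := eq_of_fderiv_apply_eq_zero (f := fun p => lowerCoord _ _ (Ψ.symm p))
      (q := Ψ (forgetTop _ _ x)) (v := forgetTop _ _ (prolong Ψ x) - Ψ (forgetTop _ _ x))
      (fun t ht => (lowerCoord _ _).differentiableAt.comp _ (hd t ht))
      (fun t ht => by
        rw [fderiv_continuousLinear_comp _ (hd t ht)]
        conv_lhs => arg 2; arg 2; rw [prolong, forgetTop_liftTop, add_sub_cancel_left]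
        rw [map_smul, map_smul, (hP' _ (hx.2 t ht)).lowerCoord_top, smul_zero])
    rw [add_sub_cancel, Ψ.left_inv hs] at this
    exact this.symm
  · simpa using jetTotal_mem q
  · rw [d3.fderiv]
    exact prolong_mem_cartan hΨ.symm hP' (hcyl q hq0)
      (prolong_mem_cartan hΨ hP hq0.1 (jetTotal_mem q))
  · simp

/-- The Lie transformation induced by an internal equivalence. -/
noncomputable def prolongHomeomorph (hΨ : E.IsInternalEquiv E' Ψ)
    (hP : ∀ p ∈ E.dom, PreservesFibers (fderiv ℝ Ψ p))
    (hP' : ∀ p ∈ E'.dom, PreservesFibers (fderiv ℝ Ψ.symm p)) :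
    OpenPartialHomeomorph (MixedJet (k + 1) (l + 2)) (MixedJet (k + 1) (l + 2)) :=
  OpenPartialHomeomorph.ofLocalInverse (prolong Ψ) (prolong Ψ.symm)
    (interior (invertible E E' Ψ)) (interior (invertible E' E Ψ.symm))
    isOpen_interior isOpen_interior
    ((contDiffOn_prolong hΨ hP).continuousOn.mono fun _ hq => (interior_subset hq).1)
    ((contDiffOn_prolong hΨ.symm hP').continuousOn.mono fun _ hq => (interior_subset hq).1)
    (fun _ hq => prolong_symm_prolong hΨ hP hP' (mem_interior_iff_mem_nhds.1 hq))
    (fun _ hq => prolong_symm_prolong (Ψ := Ψ.symm) hΨ.symm hP' hP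
      (mem_interior_iff_mem_nhds.1 hq))

variable (hΨ : E.IsInternalEquiv E' Ψ)
    (hP : ∀ p ∈ E.dom, PreservesFibers (fderiv ℝ Ψ p))
    (hP' : ∀ p ∈ E'.dom, PreservesFibers (fderiv ℝ Ψ.symm p))

lemma prolongHomeomorph_isLie : IsLieTransformation (prolongHomeomorph hΨ hP hP') := by
  have h1 : ∀ q ∈ (prolongHomeomorph hΨ hP hP').source, q ∈ E.cylinder :=
    fun q hq => (interior_subset hq.1).1
  have h2 : ∀ q ∈ (prolongHomeomorph hΨ hP hP').target, q ∈ E'.cylinder :=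
    fun q hq => (interior_subset hq.1).1
  exact IsDistributionEquiv.of_mapsTo ((contDiffOn_prolong hΨ hP).mono h1)
    ((contDiffOn_prolong hΨ.symm hP').mono h2)
    (fun q hq v hv => prolong_mem_cartan hΨ hP (h1 q hq) hv)
    (fun q hq v hv => prolong_mem_cartan hΨ.symm hP' (h2 q hq) hv)

lemma prolongHomeomorph_induces : E.Induces E' (prolongHomeomorph hΨ hP hP') Ψ :=
  fun _ hp _ => prolong_embed hΨ hP hp

lemma embed_mem_prolongHomeomorph_source {p : MongeCoord (k + 1) (l + 2)} (hp : p ∈ E.dom) :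
    E.embed p ∈ (prolongHomeomorph hΨ hP hP').source := by
  refine ⟨mem_interior_iff_mem_nhds.2 (invertible_mem_nhds hΨ hP hp), ?_⟩
  rw [Set.mem_preimage, prolong_embed hΨ hP hp]
  exact mem_interior_iff_mem_nhds.2 (invertible_mem_nhds hΨ.symm hP' (hΨ.map_mem hp))

lemma prolongHomeomorph_isExternalEquiv :
    E.IsExternalEquiv E' (prolongHomeomorph hΨ hP hP') := by
  refine ⟨prolongHomeomorph_isLie hΨ hP hP', ?_, ?_⟩
  · rintro _ ⟨p, hp, rfl⟩
    exact embed_mem_prolongHomeomorph_source hΨ hP hP' hp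
  · refine subset_antisymm ?_ ?_
    · rintro _ ⟨_, ⟨p, hp, rfl⟩, rfl⟩
      exact ⟨Ψ p, hΨ.map_mem hp, (prolong_embed hΨ hP hp).symm⟩
    · rintro _ ⟨p, hp, rfl⟩
      have hp' : Ψ.symm p ∈ E.dom := hΨ.symm.map_mem hp
      refine ⟨_, ⟨Ψ.symm p, hp', rfl⟩, ?_⟩
      refine (prolong_embed hΨ hP hp').trans ?_
      rw [Ψ.right_inv (by rwa [hΨ.2.1])]

lemma invertible_univ (h : E.dom = Set.univ) (h' : E'.dom = Set.univ)
    (f : MongeCoord (k + 1) (l + 2) → MongeCoord (k + 1) (l + 2)) :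
    invertible E E' f = Set.univ := by
  simp [invertible, h, h']

/-- With both domains equal to the whole space the segment conditions are vacuous. -/
lemma prolongHomeomorph_univ (h : E.dom = Set.univ) (h' : E'.dom = Set.univ) :
    (prolongHomeomorph hΨ hP hP').source = Set.univ ∧
      (prolongHomeomorph hΨ hP hP').target = Set.univ := by
  simp [prolongHomeomorph, OpenPartialHomeomorph.ofLocalInverse, invertible_univ h h',
    invertible_univ h' h]

end Determination

/-! ### Restriction of external symmetries -/

section Restriction

variable {m n : ℕ} {E : MongeEquation m n}

lemma eventually_restrictsTo {O : Set (MixedJet m n)} (hE : E.carrier ⊆ O)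
    {V : MixedJet m n → MixedJet m n} {X : MongeCoord m n → MongeCoord m n}
    (h : E.RestrictsTo O V X) {p : MongeCoord m n} (hp : p ∈ E.dom) :
    (fun x => V (E.embed x)) =ᶠ[𝓝 p] E.pushField X :=
  Filter.eventuallyEq_of_mem (E.isOpen_dom.mem_nhds hp) fun x hx =>
    h x hx (hE ⟨x, hx, rfl⟩)

lemma fderiv_apply_fderiv_embed {O : Set (MixedJet m n)} (hO : IsOpen O) (hE : E.carrier ⊆ O)
    {V : MixedJet m n → MixedJet m n} (hV : ContDiffOn ℝ ∞ V O)
    {p : MongeCoord m n} (hp : p ∈ E.dom) (w : MongeCoord m n) :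
    fderiv ℝ (fun x => V (E.embed x)) p w =
      fderiv ℝ V (E.embed p) (fderiv ℝ E.embed p w) := by
  have h1 := (smooth_differentiableAt hO hV (hE ⟨p, hp, rfl⟩)).hasFDerivAt
  have h2 : HasFDerivAt (fun x => V (E.embed x)) _ p := h1.comp p (E.hasFDerivAt_embed hp)
  rw [h2.fderiv]
  rfl

/-- The second derivatives of the embedding enter both halves of the bracket and cancel by symmetry.
-/
lemma RestrictsTo.lieBracket {O : Set (MixedJet m n)} (hO : IsOpen O) (hE : E.carrier ⊆ O)
    {V₁ V₂ : MixedJet m n → MixedJet m n} {X₁ X₂ : MongeCoord m n → MongeCoord m n}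
    (hV₁ : ContDiffOn ℝ ∞ V₁ O) (hV₂ : ContDiffOn ℝ ∞ V₂ O)
    (hX₁ : ContDiffOn ℝ ∞ X₁ E.dom) (hX₂ : ContDiffOn ℝ ∞ X₂ E.dom)
    (h₁ : E.RestrictsTo O V₁ X₁) (h₂ : E.RestrictsTo O V₂ X₂) :
    E.RestrictsTo O (VectorField.lieBracket ℝ V₁ V₂) (VectorField.lieBracket ℝ X₁ X₂) := by
  intro p hp hpO
  have key : ∀ {V : MixedJet m n → MixedJet m n} {X : MongeCoord m n → MongeCoord m n}
      (_ : ContDiffOn ℝ ∞ V O) (_ : ContDiffOn ℝ ∞ X E.dom) (_ : E.RestrictsTo O V X)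
      (w : MongeCoord m n), fderiv ℝ V (E.embed p) (fderiv ℝ E.embed p w) =
        fderiv ℝ (fderiv ℝ E.embed) p w (X p) + fderiv ℝ E.embed p (fderiv ℝ X p w) := by
    intro V X hV hX h w
    rw [← fderiv_apply_fderiv_embed hO hE hV hp, (eventually_restrictsTo hE h hp).fderiv_eq]
    exact fderiv_fderiv_apply E.isOpen_dom E.contDiffOn_embed hX hp w
  rw [VectorField.lieBracket, VectorField.lieBracket, h₁ p hp hpO, h₂ p hp hpO,
    key hV₂ hX₂ h₂, key hV₁ hX₁ h₁, map_sub,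
    (isSymmSndFDerivAt_of_smooth E.isOpen_dom E.contDiffOn_embed hp).eq (X₁ p) (X₂ p)]
  abel

/-- External symmetries restrict to internal ones. -/
lemma IsExternalSymmetryOn.exists_restriction {O : Set (MixedJet m n)} (hO : IsOpen O)
    (hE : E.carrier ⊆ O) {V : MixedJet m n → MixedJet m n} (hV : E.IsExternalSymmetryOn O V) :
    ∃ X : MongeCoord m n → MongeCoord m n, E.IsInternalSymmetry X ∧ E.RestrictsTo O V X := by
  have hC := ((isInfinitesimalSymmetry_cartan_iff hO).1 hV.1).2
  have hres : E.RestrictsTo O V fun p => forgetTop m n (V (E.embed p)) := by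
    intro p hp hpO
    obtain ⟨w, hw⟩ := hV.2 p hp hpO
    simp only [hw]
    rw [forgetTop_fderiv_embed E hp]
  have hsm : ContDiffOn ℝ ∞ (fun p => V (E.embed p)) E.dom :=
    hV.1.1.comp E.contDiffOn_embed fun p hp => hE ⟨p, hp, rfl⟩
  refine ⟨fun p => forgetTop m n (V (E.embed p)),
    isInternalSymmetry_iff.2 ⟨(forgetTop m n).contDiff.comp_contDiffOn hsm,
    fun p hp w hw => ?_⟩, hres⟩
  have hpO : E.embed p ∈ O := hE ⟨p, hp, rfl⟩
  obtain ⟨c1, c2⟩ := hC _ hpO _ ((mem_distribution' E).1 hw)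
  have hw1 : (fderiv ℝ E.embed p w).1 = w.1 := by rw [fderiv_embed E hp]; rfl
  rw [fderiv_continuousLinear_comp _ (smooth_differentiableAt E.isOpen_dom hsm hp),
    fderiv_apply_fderiv_embed hO hE hV.1.1 hp, ← hres p hp hpO]
  rw [hw1] at c1 c2
  exact ⟨c1, c2⟩

end Restriction

lemma PreservesTopLine.symm {m n : ℕ} {E E' : MongeEquation m n}
    {Ψ : OpenPartialHomeomorph (MongeCoord m n) (MongeCoord m n)}
    (h : E.PreservesTopLine Ψ) (hΨ : E.IsInternalEquiv E' Ψ) : E'.PreservesTopLine Ψ.symm := by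
  intro p hp
  have hp' : Ψ.symm p ∈ E.dom := hΨ.symm.map_mem hp
  have hs : Ψ.symm p ∈ Ψ.source := by rwa [hΨ.1]
  obtain ⟨c, hc⟩ := h _ hp'
  have h1 := hΨ.2.2.fderiv_symm_apply hs (dzTop m n)
  rw [hc, map_smul, Ψ.right_inv (by rwa [hΨ.2.1])] at h1
  have hc0 : c ≠ 0 := by
    rintro rfl
    rw [zero_smul] at h1
    have := congrArg (fun w : MongeCoord m n => w.2.2 (Fin.last n)) h1
    simp [dzTop] at this
  exact ⟨c⁻¹, by rw [eq_inv_smul_iff₀ hc0]; exact h1⟩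

end MongeEquation

/-! ### The main theorem -/

theorem theorem2 (m n : ℕ) (hm : 0 < m) (hmn : m ≤ n)
    (h11 : (m, n) ≠ (1, 1)) (h12 : (m, n) ≠ (1, 2)) :
    -- the algebras of internal and external infinitesimal symmetries coincide
    (∀ E : MongeEquation m n, E.NonDegenerate →
      -- every internal symmetry is the restriction of a unique external one
      (∀ X : MongeCoord m n → MongeCoord m n, E.IsInternalSymmetry X →
        ∃ V : MixedJet m n → MixedJet m n,
          E.IsExternalSymmetryOn E.cylinder V ∧ E.RestrictsTo E.cylinder V X ∧
          (∀ V' : MixedJet m n → MixedJet m n, E.IsExternalSymmetryOn E.cylinder V' →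
            E.RestrictsTo E.cylinder V' X → Set.EqOn V' V E.cylinder) ∧
          (∀ (O : Set (MixedJet m n)) (V' : MixedJet m n → MixedJet m n), IsOpen O →
            E.IsExternalSymmetryOn O V' → E.RestrictsTo O V' X →
            ∀ p ∈ E.dom, E.embed p ∈ O → V' =ᶠ[𝓝 (E.embed p)] V)) ∧
      -- every external symmetry restricts to an internal one, compatibly with brackets
      (∀ (O : Set (MixedJet m n)) (V : MixedJet m n → MixedJet m n), IsOpen O → E.carrier ⊆ O →
        E.IsExternalSymmetryOn O V →
        ∃ X : MongeCoord m n → MongeCoord m n, E.IsInternalSymmetry X ∧ E.RestrictsTo O V X) ∧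
      (∀ (O : Set (MixedJet m n)) (V₁ V₂ : MixedJet m n → MixedJet m n)
        (X₁ X₂ : MongeCoord m n → MongeCoord m n), IsOpen O → E.carrier ⊆ O →
        E.IsExternalSymmetryOn O V₁ → E.IsExternalSymmetryOn O V₂ →
        E.IsInternalSymmetry X₁ → E.IsInternalSymmetry X₂ →
        E.RestrictsTo O V₁ X₁ → E.RestrictsTo O V₂ X₂ →
        E.RestrictsTo O (VectorField.lieBracket ℝ V₁ V₂) (VectorField.lieBracket ℝ X₁ X₂))) ∧
    -- every internal equivalence is induced by a unique Lie transformation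
    (∀ E E' : MongeEquation m n, E.NonDegenerate → E'.NonDegenerate →
      ∀ Ψ : OpenPartialHomeomorph (MongeCoord m n) (MongeCoord m n), E.IsInternalEquiv E' Ψ →
        ((m, n) = (2, 2) → E.PreservesTopLine Ψ) →
        -- near the equations, with uniqueness of germs
        (∃ Φ : OpenPartialHomeomorph (MixedJet m n) (MixedJet m n),
          E.IsExternalEquiv E' Φ ∧ E.Induces E' Φ Ψ ∧
          ∀ Φ' : OpenPartialHomeomorph (MixedJet m n) (MixedJet m n), IsLieTransformation Φ' →
            E.Induces E' Φ' Ψ →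
            ∀ p ∈ E.dom, E.embed p ∈ Φ'.source → Φ' =ᶠ[𝓝 (E.embed p)] Φ) ∧
        -- on the whole jet space, if both right-hand sides are defined everywhere
        (E.dom = Set.univ → E'.dom = Set.univ →
          ∃! Φ : OpenPartialHomeomorph (MixedJet m n) (MixedJet m n),
            Φ.source = Set.univ ∧ Φ.target = Set.univ ∧
            E.IsExternalEquiv E' Φ ∧ E.Induces E' Φ Ψ)) := by
  obtain ⟨k, rfl⟩ := Nat.exists_eq_add_one.2 hm
  obtain ⟨l, rfl⟩ : ∃ l, n = l + 2 := by
    refine ⟨n - 2, ?_⟩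
    have : n ≠ 1 := fun h => h11 (by rw [h] at hmn ⊢; rw [Nat.le_antisymm hmn hm])
    omega
  -- With m = k + 1 and n = l + 2 this says that m = 1 forces n ≥ 3.
  have hkl : k = 0 → 0 < l := fun h => by
    by_contra hl
    exact h12 (by rw [h, Nat.eq_zero_of_not_pos hl])
  refine ⟨fun E hE => ⟨fun X hX => ?_, fun O V hO hEO hV => hV.exists_restriction hO hEO,
    fun O V₁ V₂ X₁ X₂ hO hEO hV₁ hV₂ hX₁ hX₂ h₁ h₂ =>
      MongeEquation.RestrictsTo.lieBracket hO hEO hV₁.1.1 hV₂.1.1 hX₁.1 hX₂.1 h₁ h₂⟩,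
    fun E E' hE hE' Ψ hΨ h22 => ?_⟩
  · have hP : ∀ p ∈ E.dom, PreservesFibers (fderiv ℝ X p) :=
      fun p hp => hX.preservesFibers hE hkl hp
    refine ⟨MongeEquation.prolongField X,
      ⟨MongeEquation.prolongField_isInfinitesimalSymmetry hX hP,
        fun p hp _ => ⟨X p, MongeEquation.prolongField_embed hX hp⟩⟩,
      fun p hp _ => MongeEquation.prolongField_embed hX hp, fun V' hV' hr q hq => ?_,
      fun O V' hO hV' hr p hp hpO => ?_⟩
    · refine MongeEquation.field_eq_prolongField hX hP E.isOpen_cylinder hV'.1 hr ?_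
      rw [E.fiberStar_cylinder]
      exact E.isOpen_cylinder.mem_nhds hq
    · filter_upwards [eventually_mem_nhds_iff.2 (E.fiberStar_mem_nhds hO hp hpO)] with q hq
      exact MongeEquation.field_eq_prolongField hX hP hO hV'.1 hr hq
  -- If n = 2 then m is 1 or 2, and (1, 2) is excluded, so the extra assumption for (2, 2) applies.
  · have hl : l = 0 → E.PreservesTopLine Ψ := fun h => h22 (by
      have : k ≠ 0 := fun h0 => (hkl h0).ne' h
      have : k = 1 := by omega
      rw [this, h])
    have hP : ∀ p ∈ E.dom, PreservesFibers (fderiv ℝ Ψ p) :=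
      fun p hp => hΨ.preservesFibers hE hkl hl hp
    have hP' : ∀ p ∈ E'.dom, PreservesFibers (fderiv ℝ Ψ.symm p) :=
      fun p hp => hΨ.symm.preservesFibers hE' hkl (fun h => (hl h).symm hΨ) hp
    refine ⟨⟨MongeEquation.prolongHomeomorph hΨ hP hP',
      MongeEquation.prolongHomeomorph_isExternalEquiv hΨ hP hP',
      MongeEquation.prolongHomeomorph_induces hΨ hP hP', fun Φ' hΦ' hind p hp hps => ?_⟩,
      fun hu hu' => ?_⟩
    · filter_upwards [eventually_mem_nhds_iff.2
        (E.fiberStar_mem_nhds Φ'.open_source hp hps)] with q hq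
      exact MongeEquation.eq_prolong hΨ hP hΦ' hind hq
    · obtain ⟨hsrc, htgt⟩ := MongeEquation.prolongHomeomorph_univ hΨ hP hP' hu hu'
      refine ⟨MongeEquation.prolongHomeomorph hΨ hP hP', ⟨hsrc, htgt,
        MongeEquation.prolongHomeomorph_isExternalEquiv hΨ hP hP',
        MongeEquation.prolongHomeomorph_induces hΨ hP hP'⟩, ?_⟩
      rintro Φ ⟨hs, ht, hext, hind⟩
      have heq : ∀ q, Φ q = MongeEquation.prolongHomeomorph hΨ hP hP' q := fun q => by
        refine MongeEquation.eq_prolong hΨ hP hext.1 hind ?_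
        have : E.fiberStar Φ.source = Set.univ := by
          simp [MongeEquation.fiberStar, hs, hu]
        rw [this]
        exact Filter.univ_mem
      -- Equality also requires the inverse functions to agree; this follows from `heq` because
      -- sources and targets are the whole space.
      refine OpenPartialHomeomorph.ext _ _ heq (fun q => ?_) (by rw [hs, hsrc])
      set Φ₀ := MongeEquation.prolongHomeomorph hΨ hP hP'
      have hq : q ∈ Φ₀.target := by rw [htgt]; trivial
      conv_lhs => rw [← Φ₀.right_inv hq, ← heq, Φ.left_inv (by rw [hs]; trivial)]
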